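/- **Setting.** A POMDP with finite state, action, observation and reward spaces of sizes $\mathcal S,\mathcal A,\Omega,\mathcal R$ is given by a dynamic decision network (DDN): a Bayesian network over the $N$ binary random variables that make up $S_t,A_t,S_{t+1},O_{t+1},R_{t+1}$ in one time slice, with CPTs for $P(S_{t+1}\mid S_t,A_t)$, $P(O_{t+1}\mid S_{t+1},A_t)$ and $P(R_{t+1}\mid S_t,A_t)$. The variables of $A_t$ are roots; as a belief may be an arbitrary distribution of $S_t$, the variables of $S_t$ form a complete subnetwork. $M$ is the largest number of parents of a variable. Let $0<\gamma<1$ be the discount factor and $\Gamma=(1-\gamma)^{-1}$. **Algorithm.** The quantum-classical lookahead with horizon $H$ explores, from a given belief, the full tree of actions and observations with belief nodes at depths $0,\dots,H-1$. At each belief node $b$ and for each action $a$ it takes $n$ samples of the reward and $m=\lceil(\gamma\Gamma)^2n\rceil$ samples of the observation by classical direct sampling; if there is a further layer, then for each observation $o$ it takes $$l=\left\lceil\left(\tfrac14\,\tfrac{\mathcal R+\gamma\Gamma\Omega}{\mathcal S-1}\Big(\tfrac{\mathcal S}{\Gamma(1-\gamma^H)}\sum_{k=0}^{H-1}(\gamma\mathcal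 S)^k-1\Big)\right)^2 n\right\rceil$$ samples of $S_{t+1}$ given $b,a,o$ by quantum rejection sampling, whose empirical distribution is the child belief. (One sample: prepare the network state by uniformly controlled $R_Y$ rotations, apply the amplitude amplification operator a random number of times, drawn uniformly from $\{0,\dots,\lceil(6/5)^r\rceil-1\}$ in attempt $r=0,1,\dots$, measure, and repeat until the measured observation is $o$.) The value of $(b,a)$ is the mean sampled reward plus $\gamma$ times the mean, over the observation samples, of the values of the child beliefs, the value of a belief being the maximum over $a$ and values beyond the horizon being $0$; an action of maximal value at the root is returned. Time counts elementary gates ($X$, $Z$, $R_Y$, CNOT, Toffoli), qubit resets, measurements and elementary classical steps. Let $\Phi$ be the family of the observation probabilities $P(o\mid b,a)$ over all branches of the lookahead tree that lead from a belief node to a child belief node, and $q_l=\sum_{p\in\Phi}p^{-1/2}\in[0,\infty]$ (with $0^{-1/2}=\infty$). The running time and $q_l$ are random, because the algorithm is. **Theorem.** Suppose $\mathcal S\ge 2$, $\mathcal A\Omega\ge2$, $H\ge1$, and that the network is sparse in the sense that $2^M\le\kappa M$. 1. For every $n\ge1$ the expected running time of one lookahead is at most $$C\,\kappa\; n N M\,\mathcal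 A^{H-1}\Omega^{H-1}\Big(\mathcal A+\big((\mathcal R+\Omega)\mathcal S^{H-1}\big)^2\,\mathbb E[q_l]\Big),$$ where $C$ depends only on $\gamma$. 2. Let $r_{\max}>0$ be the largest absolute value of a reward, $0<\eta<1$, $T\ge1$ a stopping time, $0<\delta<1$ and $0<\varepsilon\le 2\Gamma r_{\max}$, and suppose that the horizon is so large that $2\gamma^H\Gamma r_{\max}\le\eta\,\varepsilon$. Let $n$ be the number of samples prescribed for accuracy $\varepsilon$ and confidence $1-\delta$ up to time $T$: $$n=\left\lceil\tfrac12\log\tfrac2\sigma\Big(\tfrac{r_{\max}}{\varepsilon-2\gamma^H\Gamma r_{\max}}(8\Gamma+4\mathcal S^T)\Big)^2\right\rceil,\qquad \sigma=\delta(\mathcal A\Omega)^{-H}\Big(2+\mathcal A\big(T+4+\mathcal A\Omega\tfrac{H-1}{(\mathcal A\Omega-1)^2}\big)\Big)^{-1}.$$ Then the expected running time of one lookahead is at most $$C'\,\kappa\; N M\,\mathcal A^{H-1}\Omega^{H-1}\Big(\mathcal A+\big((\mathcal R+\Omega)\mathcal S^{H-1}\big)^2\,\mathbb E[q_l]\Big)\Big(\frac{\mathcal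 S^T}{\varepsilon}\Big)^2\log\!\Big(\big(T+\tfrac{H}{\mathcal A\Omega}\big)\frac{\mathcal A^{H+1}\Omega^H}{\delta}\Big),$$ where $C'$ depends only on $\gamma$, $r_{\max}$ and $\eta$. -/

import Mathlib

open scoped NNReal ENNReal

noncomputable section

namespace QBRL

/-! ### Randomized computations with a clock

A computation is a finite-step probabilistic program. Its semantics is the joint law of its result
(`none` if it was cut off) and of a log. The log holds the number of elementary steps executed so
far and the multiset of the observation probabilities met in the lookahead tree. The second
component is only a record for the analysis: it costs nothing and no computation reads it. -/

/-- Number of elementary steps, and the multiset of recorded observation probabilities. -/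
abbrev Log : Type := ℕ × Multiset ℝ

/-- Randomized computations: the law of (result, log). The result `none` means "cut off". -/
def Run (α : Type) : Type := PMF (Option α × Log)

namespace Run

/-- Sequential composition: logs add up, and nothing is executed after a cut-off. -/
protected def bind {α β : Type} (x : Run α) (f : α → Run β) : Run β :=
  PMF.bind x fun w =>
    match w.1 with
    | none => PMF.pure (none, w.2)
    | some a => PMF.map (fun u : Option β × Log => (u.1, w.2 + u.2)) (f a)

instance : Monad Run where
  pure a := PMF.pure (some a, 0)
  bind := Run.bind

/-- Spend `c` elementary steps. -/
def tick (c : ℕ) : Run Unit := PMF.pure (some (), (c, 0))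

/-- Record an observation probability of the lookahead tree. -/
def record (p : ℝ) : Run Unit := PMF.pure (some (), (0, {p}))

/-- A random outcome with law `μ`; its cost is charged separately. -/
def draw {α : Type} (μ : PMF α) : Run α := PMF.map (fun a => (some a, 0)) μ

/-- The computation is cut off. -/
def cut {α : Type} : Run α := PMF.pure (none, 0)

/-- Execute `f` on the entries of a list, from left to right. -/
def mapList {α β : Type} (f : α → Run β) : List α → Run (List β)
  | [] => pure []
  | a :: as => do
      let y ← f a
      let ys ← mapList f as
      pure (y :: ys)

/-- Execute `x` independently `k` times. -/
def times {α : Type} (x : Run α) : ℕ → Run (List α)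
  | 0 => pure []
  | k + 1 => do
      let y ← x
      let ys ← times x k
      pure (y :: ys)

/-- Expectation of a function of the log. -/
def expect {α : Type} (x : Run α) (f : Log → ℝ≥0∞) : ℝ≥0∞ :=
  ∑' w : Option α × Log, (show PMF (Option α × Log) from x) w * f w.2

end Run

/-- A biased coin. -/
def coin (p : unitInterval) : PMF Bool :=
  PMF.ofFintype (fun y => if y then ENNReal.ofReal p else ENNReal.ofReal (1 - p)) (by
    rw [Fintype.sum_bool]
    simp only [if_true, Bool.false_eq_true, if_false]
    rw [← ENNReal.ofReal_add p.2.1 (sub_nonneg.2 p.2.2)]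
    simp)

/-! ### Quantum circuits -/

/-- Elementary gates on a set `Q` of qubits: Pauli `X` and `Z`, the rotation `R_Y(θ)`, the
controlled NOT (control, target) and the Toffoli gate (two controls, target). -/
inductive Gate (Q : Type) : Type
  | x (q : Q)
  | z (q : Q)
  | ry (θ : ℝ) (q : Q)
  | cx (c t : Q)
  | ccx (c d t : Q)

/-- State vectors: amplitudes of the computational basis states. -/
abbrev QState (Q : Type) : Type := (Q → Bool) → ℂ

section Circuits

variable {Q : Type} [DecidableEq Q]

/-- Negate the bit of `t`. -/
def flipBit (t : Q) (y : Q → Bool) : Q → Bool := Function.update y t (!y t)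

/-- Negate the bit of `t` if the bits of `c` and `d` are both `1`. (The degenerate case in which
the target is one of the controls is taken to be the identity; it is never used.) -/
def toffoliMap (c d t : Q) (y : Q → Bool) : Q → Bool :=
  if c ≠ t ∧ d ≠ t ∧ y c = true ∧ y d = true then flipBit t y else y

/-- Action of an elementary gate on state vectors. -/
def Gate.apply : Gate Q → QState Q → QState Q
  | .x q, ψ => fun y => ψ (flipBit q y)
  | .z q, ψ => fun y => if y q then -ψ y else ψ y
  | .ry θ q, ψ => fun y =>
      (Real.cos (θ / 2) : ℂ) * ψ y +
        (if y q then (Real.sin (θ / 2) : ℂ) else -(Real.sin (θ / 2) : ℂ)) * ψ (flipBit q y)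
  | .cx c t, ψ => fun y => ψ (toffoliMap c c t y)
  | .ccx c d t, ψ => fun y => ψ (toffoliMap c d t y)

/-- The inverse gate. -/
def Gate.inv : Gate Q → Gate Q
  | .ry θ q => .ry (-θ) q
  | g => g

/-- A circuit is a list of elementary gates, the first one being applied first. Its size is the
length of the list. -/
abbrev Circuit (Q : Type) : Type := List (Gate Q)

/-- Action of a circuit on state vectors. -/
def Circuit.apply (c : Circuit Q) (ψ : QState Q) : QState Q :=
  c.foldl (fun φ g => g.apply φ) ψ

/-- The inverse circuit. -/
def Circuit.inv (c : Circuit Q) : Circuit Q := (c.map Gate.inv).reverse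

theorem flipBit_flipBit (t : Q) (y : Q → Bool) : flipBit t (flipBit t y) = y := by
  simp [flipBit]

theorem toffoliMap_toffoliMap (c d t : Q) (y : Q → Bool) :
    toffoliMap c d t (toffoliMap c d t y) = y := by
  by_cases h : c ≠ t ∧ d ≠ t ∧ y c = true ∧ y d = true
  · have h1 : toffoliMap c d t y = flipBit t y := if_pos h
    have h2 : c ≠ t ∧ d ≠ t ∧ flipBit t y c = true ∧ flipBit t y d = true := by
      refine ⟨h.1, h.2.1, ?_, ?_⟩
      · simp [flipBit, Function.update_of_ne h.1, h.2.2.1]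
      · simp [flipBit, Function.update_of_ne h.2.1, h.2.2.2]
    rw [h1]
    unfold toffoliMap
    rw [if_pos h2, flipBit_flipBit]
  · have h1 : toffoliMap c d t y = y := if_neg h
    rw [h1, h1]

variable [Fintype Q]

/-- The state `|0…0⟩`. -/
def zeroState : QState Q := fun y => if ∀ q, y q = false then 1 else 0

theorem sum_comp_involutive {f : (Q → Bool) → (Q → Bool)} (hf : Function.Involutive f)
    (g : (Q → Bool) → ℝ) : ∑ y, g (f y) = ∑ y, g y :=
  Fintype.sum_equiv hf.toPerm _ _ fun _ => rfl

theorem Gate.sum_normSq_apply (g : Gate Q) (ψ : QState Q) :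
    ∑ y, Complex.normSq (g.apply ψ y) = ∑ y, Complex.normSq (ψ y) := by
  cases g with
  | x q => exact sum_comp_involutive (flipBit_flipBit q) fun y => Complex.normSq (ψ y)
  | z q =>
      refine Finset.sum_congr rfl fun y _ => ?_
      by_cases h : y q = true <;> simp [Gate.apply, h]
  | cx c t => exact sum_comp_involutive (toffoliMap_toffoliMap c c t) fun y => Complex.normSq (ψ y)
  | ccx c d t =>
      exact sum_comp_involutive (toffoliMap_toffoliMap c d t) fun y => Complex.normSq (ψ y)
  | ry θ q =>
      have key : ∀ y : Q → Bool,
          Complex.normSq ((Gate.ry θ q).apply ψ y) +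
            Complex.normSq ((Gate.ry θ q).apply ψ (flipBit q y)) =
          Complex.normSq (ψ y) + Complex.normSq (ψ (flipBit q y)) := by
        intro y
        have hq : flipBit q y q = !y q := by simp [flipBit]
        have hcs := Real.sin_sq_add_cos_sq (θ / 2)
        simp only [Gate.apply, flipBit_flipBit, hq]
        generalize Real.sin (θ / 2) = s at *
        generalize Real.cos (θ / 2) = c at *
        generalize ψ y = u
        generalize ψ (flipBit q y) = v
        cases y q <;>
          simp [Complex.normSq_apply] <;>
          linear_combination (u.re ^ 2 + u.im ^ 2 + v.re ^ 2 + v.im ^ 2) * hcs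
      have h1 := sum_comp_involutive (flipBit_flipBit q)
        fun y => Complex.normSq ((Gate.ry θ q).apply ψ y)
      have h2 := sum_comp_involutive (flipBit_flipBit q) fun y => Complex.normSq (ψ y)
      have h3 := Finset.sum_congr rfl fun (y : Q → Bool) (_ : y ∈ Finset.univ) => key y
      rw [Finset.sum_add_distrib, Finset.sum_add_distrib] at h3
      linarith

theorem Circuit.sum_normSq_apply (c : Circuit Q) (ψ : QState Q) :
    ∑ y, Complex.normSq (c.apply ψ y) = ∑ y, Complex.normSq (ψ y) := by
  induction c generalizing ψ with
  | nil => rfl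
  | cons g c ih => exact (ih (g.apply ψ)).trans (g.sum_normSq_apply ψ)

theorem sum_normSq_zeroState : ∑ y : Q → Bool, Complex.normSq (zeroState y) = 1 := by
  rw [Finset.sum_eq_single (fun _ => false)]
  · simp [zeroState]
  · intro y _ hy
    have : ¬ ∀ q, y q = false := fun h => hy (funext h)
    simp [zeroState, this]
  · simp

/-- Law of the outcome when all qubits are measured after the circuit has been run on `|0…0⟩`. -/
def Circuit.measure (c : Circuit Q) : PMF (Q → Bool) :=
  PMF.ofFintype (fun y => ENNReal.ofReal (Complex.normSq (c.apply zeroState y))) (by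
    rw [← ENNReal.ofReal_sum_of_nonneg fun y _ => Complex.normSq_nonneg _,
      c.sum_normSq_apply, sum_normSq_zeroState, ENNReal.ofReal_one])

end Circuits

/-! ### Bayesian networks over binary random variables -/

/-- A Bayesian network: a directed acyclic graph, given by the parent sets together with a
topological order, and a conditional probability table; `cpt v x` is the probability of `X_v = 1`
when the parents of `v` have the values prescribed by `x`. -/
structure BayesNet (V : Type) [DecidableEq V] where
  order : List V
  order_nodup : order.Nodup
  mem_order : ∀ v, v ∈ order
  parents : V → Finset V
  parents_before : ∀ v, ∀ u ∈ parents v, order.idxOf u < order.idxOf v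
  cpt : V → (V → Bool) → unitInterval
  cpt_congr : ∀ v x y, (∀ u ∈ parents v, x u = y u) → cpt v x = cpt v y

namespace BayesNet

variable {V : Type} [DecidableEq V]

/-- `P(X_v = x_v | parents of v)`. -/
def factor (B : BayesNet V) (v : V) (x : V → Bool) : ℝ :=
  if x v then (B.cpt v x : ℝ) else 1 - B.cpt v x

/-- The joint distribution. -/
def joint [Fintype V] (B : BayesNet V) (x : V → Bool) : ℝ := ∏ v, B.factor v x

/-- The largest number of parents. -/
def maxParents [Fintype V] (B : BayesNet V) : ℕ := Finset.univ.sup fun v => (B.parents v).card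

/-! #### Direct sampling -/

/-- Draw the variables of a list one after the other. Each one costs one step for every parent
value that is read, and one step for the draw. -/
def directSampleFrom (B : BayesNet V) : List V → (V → Bool) → Run (V → Bool)
  | [], x => pure x
  | v :: vs, x => do
      Run.tick ((B.parents v).card + 1)
      let y ← Run.draw (coin (B.cpt v x))
      directSampleFrom B vs (Function.update x v y)

/-- Direct (ancestral) sampling. -/
def directSample (B : BayesNet V) : Run (V → Bool) := B.directSampleFrom B.order fun _ => false

/-! #### Encoding circuit and amplitude amplification

There is one qubit `Sum.inl v` for every random variable `v`; the qubits `Sum.inr _` are ancillas,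
which every block of gates below returns to `|0⟩`. -/

/-- The uniformly controlled rotation of the target `t` by the angle `θ x`, where `θ` depends only
on the bits of the listed controls, decomposed into `R_Y` and `CNOT` gates. -/
def uniformlyControlledRy (t : V) : List V → ((V → Bool) → ℝ) → Circuit (V ⊕ Option V)
  | [], θ => [Gate.ry (θ fun _ => false) (Sum.inl t)]
  | c :: cs, θ =>
      uniformlyControlledRy t cs
          (fun x => (θ (Function.update x c false) + θ (Function.update x c true)) / 2) ++
        [Gate.cx (Sum.inl c) (Sum.inl t)] ++
      uniformlyControlledRy t cs
          (fun x => (θ (Function.update x c false) - θ (Function.update x c true)) / 2) ++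
        [Gate.cx (Sum.inl c) (Sum.inl t)]

/-- The state preparation circuit: for every random variable, in topological order, a rotation
controlled by its parents. The angle `2 arcsin √P(X_v = 1 | ·)` is
`2 arctan √(P(X_v = 1 | ·) / P(X_v = 0 | ·))`, also when the denominator vanishes. -/
def encode (B : BayesNet V) : Circuit (V ⊕ Option V) :=
  B.order.flatMap fun v =>
    uniformlyControlledRy v (B.parents v).toList
      fun x => 2 * Real.arcsin (Real.sqrt (B.cpt v x))

/-- Collect the conjunction of the listed bits in ancillas by a ladder of Toffoli gates, starting
from the ancilla `acc`, flip the phase, and undo the ladder. -/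
def phaseLadder : Option V → List V → Circuit (V ⊕ Option V)
  | acc, [] => [Gate.z (Sum.inr acc)]
  | acc, v :: vs =>
      [Gate.ccx (Sum.inr acc) (Sum.inl v) (Sum.inr (some v))] ++ phaseLadder (some v) vs ++
        [Gate.ccx (Sum.inr acc) (Sum.inl v) (Sum.inr (some v))]

/-- Flip the phase of the basis states in which every listed variable has the prescribed value. -/
def phaseFlip (vs : List V) (e : V → Bool) : Circuit (V ⊕ Option V) :=
  (vs.filter fun v => !e v).map (fun v => Gate.x (Sum.inl v)) ++
    ([Gate.x (Sum.inr none)] ++ phaseLadder none vs ++ [Gate.x (Sum.inr none)]) ++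
  (vs.filter fun v => !e v).map (fun v => Gate.x (Sum.inl v))

/-- The amplitude amplification operator `B S₀ B† S_e` (`S_e` is applied first), for the evidence
that the variables in `ev` have the values prescribed by `e`. -/
def amplify (B : BayesNet V) (ev : List V) (e : V → Bool) : Circuit (V ⊕ Option V) :=
  phaseFlip ev e ++ B.encode.inv ++ phaseFlip B.order (fun _ => false) ++ B.encode

/-- Encode the network, then apply the amplitude amplification operator `k` times. -/
def amplified (B : BayesNet V) (ev : List V) (e : V → Bool) (k : ℕ) : Circuit (V ⊕ Option V) :=
  B.encode ++ (List.replicate k (B.amplify ev e)).flatten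

/-- In the `r`-th attempt the number of amplification steps is drawn uniformly from
`{0, …, searchRange r - 1}`; this range grows exponentially. -/
def searchRange (r : ℕ) : ℕ := ⌈(6 / 5 : ℝ) ^ r⌉₊

theorem searchRange_pos (r : ℕ) : 0 < searchRange r := Nat.ceil_pos.2 (by positivity)

/-- Quantum rejection sampling, from the `r`-th attempt on and with at most `fuel` attempts, for
evidence of unknown probability. An attempt draws the number `k` of amplification steps (one step),
resets all qubits (one step per qubit), runs the circuit (one step per gate), measures the qubits
of the random variables (one step each) and compares the outcome with the evidence (one step per
evidence variable). The outcome is accepted if the evidence matches; otherwise there is a new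
attempt. -/
def quantumSample [Fintype V] (B : BayesNet V) (ev : List V) (e : V → Bool) :
    (fuel : ℕ) → (r : ℕ) → Run (V → Bool)
  | 0, _ => Run.cut
  | fuel + 1, r => do
      let k ← Run.draw (PMF.uniformOfFinset (Finset.range (searchRange r))
        (Finset.nonempty_range_iff.2 (searchRange_pos r).ne'))
      Run.tick (1 + Fintype.card (V ⊕ Option V) + (B.amplified ev e k).length +
        Fintype.card V + ev.length)
      let y ← Run.draw (Circuit.measure (B.amplified ev e k))
      if ∀ v ∈ ev, y (Sum.inl v) = e v then
        pure fun v => y (Sum.inl v)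
      else
        quantumSample B ev e fuel (r + 1)

end BayesNet

/-! ### Dynamic decision networks -/

/-- Bit strings. -/
abbrev Bits (k : ℕ) : Type := Fin k → Bool

/-- The random variables of one time slice: `S_t`, `A_t`, `S_{t+1}`, `O_{t+1}` and `R_{t+1}`, each
made of binary random variables. -/
abbrev Var (kS kA kO kR : ℕ) : Type := Fin kS ⊕ Fin kA ⊕ Fin kS ⊕ Fin kO ⊕ Fin kR

namespace Var

variable {kS kA kO kR : ℕ}

/-- The bits of `S_t`. -/
abbrev cur (i : Fin kS) : Var kS kA kO kR := Sum.inl i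
/-- The bits of `A_t`. -/
abbrev act (i : Fin kA) : Var kS kA kO kR := Sum.inr (Sum.inl i)
/-- The bits of `S_{t+1}`. -/
abbrev nxt (i : Fin kS) : Var kS kA kO kR := Sum.inr (Sum.inr (Sum.inl i))
/-- The bits of `O_{t+1}`. -/
abbrev obs (i : Fin kO) : Var kS kA kO kR := Sum.inr (Sum.inr (Sum.inr (Sum.inl i)))
/-- The bits of `R_{t+1}`. -/
abbrev rew (i : Fin kR) : Var kS kA kO kR := Sum.inr (Sum.inr (Sum.inr (Sum.inr i)))

/-- The values of `S_t`, `A_t`, `S_{t+1}`, `O_{t+1}`, `R_{t+1}` in a joint assignment. -/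
abbrev curOf (x : Var kS kA kO kR → Bool) : Bits kS := fun i => x (cur i)
abbrev actOf (x : Var kS kA kO kR → Bool) : Bits kA := fun i => x (act i)
abbrev nxtOf (x : Var kS kA kO kR → Bool) : Bits kS := fun i => x (nxt i)
abbrev obsOf (x : Var kS kA kO kR → Bool) : Bits kO := fun i => x (obs i)
abbrev rewOf (x : Var kS kA kO kR → Bool) : Bits kR := fun i => x (rew i)

end Var

open Var

/-- A dynamic decision network for a POMDP whose states, actions, observations and rewards are
encoded by bit strings. It is a Bayesian network over one time slice. The actions are roots. The
belief about `S_t` may be any distribution, so the bits of `S_t` form a complete subnetwork.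
The transition dynamics, the sensor model and the reward dynamics are arbitrary CPTs of the form
`P(S_{t+1} | S_t, A_t)`, `P(O_{t+1} | S_{t+1}, A_t)` and `P(R_{t+1} | S_t, A_t)`. The finite sets
`states`, `actions`, `observations`, `rewards` are the spaces of the POMDP (the bit strings in
use), and the dynamics do not leave them. -/
structure DDN (kS kA kO kR : ℕ) extends BayesNet (Var kS kA kO kR) where
  parents_cur : ∀ i, parents (cur i) = (Finset.univ.filter fun j => j < i).image cur
  parents_act : ∀ i, parents (act i) = ∅
  parents_nxt : ∀ i, ∀ u ∈ parents (nxt i),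
    (∃ j, u = cur j) ∨ (∃ j, u = act j) ∨ (∃ j, u = nxt j)
  parents_obs : ∀ i, ∀ u ∈ parents (obs i),
    (∃ j, u = nxt j) ∨ (∃ j, u = act j) ∨ (∃ j, u = obs j)
  parents_rew : ∀ i, ∀ u ∈ parents (rew i),
    (∃ j, u = cur j) ∨ (∃ j, u = act j) ∨ (∃ j, u = rew j)
  states : Finset (Bits kS)
  actions : Finset (Bits kA)
  observations : Finset (Bits kO)
  rewards : Finset (Bits kR)
  rewardValue : Bits kR → ℝ
  support_nxt : ∀ x, curOf x ∈ states → actOf x ∈ actions → nxtOf x ∉ states →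
    ∏ i, toBayesNet.factor (nxt i) x = 0
  support_obs : ∀ x, nxtOf x ∈ states → actOf x ∈ actions → obsOf x ∉ observations →
    ∏ i, toBayesNet.factor (obs i) x = 0
  support_rew : ∀ x, curOf x ∈ states → actOf x ∈ actions → rewOf x ∉ rewards →
    ∏ i, toBayesNet.factor (rew i) x = 0

/-- Weights on the states; see `DDN.IsBelief`. -/
abbrev Belief (kS : ℕ) : Type := Bits kS → ℝ≥0

/-- The total weight of the states that agree with `s` on the bits before `i`, and, for `one`, have
bit `i` equal to `1`. -/
def Belief.mass {kS : ℕ} (b : Belief kS) (i : Fin kS) (s : Bits kS) (one : Bool) : ℝ≥0 :=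
  ∑ s' : Bits kS, if (∀ j < i, s' j = s j) ∧ (one = true → s' i = true) then b s' else 0

/-- The probability under `b` that bit `i` is `1`, given the bits before `i`. -/
def Belief.cond {kS : ℕ} (b : Belief kS) (i : Fin kS) (s : Bits kS) : unitInterval :=
  ⟨((b.mass i s true / b.mass i s false : ℝ≥0) : ℝ), NNReal.coe_nonneg _, by
    have h : b.mass i s true ≤ b.mass i s false := by
      refine Finset.sum_le_sum fun s' _ => ?_
      by_cases h1 : ∀ j < i, s' j = s j
      · by_cases h2 : s' i = true <;> simp [h2]
      · simp [h1]
    exact_mod_cast div_le_one_of_le₀ h zero_le⟩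

theorem Belief.cond_congr {kS : ℕ} (b : Belief kS) (i : Fin kS) (s s' : Bits kS)
    (h : ∀ j < i, s j = s' j) : b.cond i s = b.cond i s' := by
  have key : ∀ one, b.mass i s one = b.mass i s' one := by
    intro one
    refine Finset.sum_congr rfl fun u _ => ?_
    have : (∀ j < i, u j = s j) ↔ (∀ j < i, u j = s' j) :=
      forall₂_congr fun j hj => by rw [h j hj]
    simp only [this]
  unfold Belief.cond
  simp only [key]

/-- The empirical distribution of a list of samples. -/
def Belief.empirical {kS : ℕ} (l : List (Bits kS)) : Belief kS :=
  fun s => (l.count s : ℝ≥0) / (l.length : ℝ≥0)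

namespace DDN

variable {kS kA kO kR : ℕ} (D : DDN kS kA kO kR)

/-- `b` is a probability distribution on the state space. -/
def IsBelief (b : Belief kS) : Prop := ∑ s, b s = 1 ∧ ∀ s, b s ≠ 0 → s ∈ D.states

/-- The sizes of the state, action, observation and reward spaces. -/
def sizeS : ℕ := D.states.card
def sizeA : ℕ := D.actions.card
def sizeO : ℕ := D.observations.card
def sizeR : ℕ := D.rewards.card

/-- The number of random variables. -/
def numVars (_D : DDN kS kA kO kR) : ℕ := Fintype.card (Var kS kA kO kR)

/-- The CPTs of the network when `S_t` has law `b` and `A_t = a`. -/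
def sliceCpt (b : Belief kS) (a : Bits kA) :
    Var kS kA kO kR → (Var kS kA kO kR → Bool) → unitInterval
  | Sum.inl i, x => b.cond i (curOf x)
  | Sum.inr (Sum.inl i), _ => if a i then 1 else 0
  | Sum.inr (Sum.inr v), x => D.cpt (Sum.inr (Sum.inr v)) x

/-- The network in which the belief `b` and the action `a` are encoded. -/
def slice (b : Belief kS) (a : Bits kA) : BayesNet (Var kS kA kO kR) where
  order := D.order
  order_nodup := D.order_nodup
  mem_order := D.mem_order
  parents := D.parents
  parents_before := D.parents_before
  cpt := D.sliceCpt b a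
  cpt_congr := by
    intro v x y h
    match v, h with
    | Sum.inl i, h =>
        refine b.cond_congr i _ _ fun j hj => h _ ?_
        have := D.parents_cur i
        simp only [this, Finset.mem_image, Finset.mem_filter, Finset.mem_univ, true_and]
        exact ⟨j, hj, rfl⟩
    | Sum.inr (Sum.inl i), h => rfl
    | Sum.inr (Sum.inr v), h => exact D.cpt_congr _ x y h

/-- The observation probability `P(O_{t+1} = o | b, a)`. -/
def obsProb (b : Belief kS) (a : Bits kA) (o : Bits kO) : ℝ :=
  ∑ x : Var kS kA kO kR → Bool, if obsOf x = o then (D.slice b a).joint x else 0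

/-- The quantum belief update: `l` samples of `S_{t+1}` given `O_{t+1} = o` are taken by quantum
rejection sampling, and the new belief is their empirical distribution. Computing the rotation
angles that encode `b` costs `kS 2^kS` steps, and tabulating the samples costs `kS` steps each. -/
def beliefUpdate (l fuel : ℕ) (b : Belief kS) (a : Bits kA) (o : Bits kO) : Run (Belief kS) := do
  Run.tick (kS * 2 ^ kS)
  let xs ← Run.times ((D.slice b a).quantumSample ((List.finRange kO).map obs)
    (Sum.elim (fun _ => false) (Sum.elim (fun _ => false)
      (Sum.elim (fun _ => false) (Sum.elim o (fun _ => false))))) fuel 0) l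
  Run.tick (l * kS)
  pure (Belief.empirical (xs.map nxtOf))

/-- The quantum-classical lookahead from belief `b` with `h` remaining layers. For each action, `n`
reward samples and `m` observation samples are taken by direct sampling. If there is a further
layer, then for each observation `o` the belief is updated by quantum rejection sampling with `l`
samples and the value of the new belief is computed recursively (`P(o | b, a)` is recorded). The
value of the action is the mean of the rewards plus `γ` times the mean, over the observation
samples, of the values of the corresponding beliefs; values beyond the horizon are `0`. The result
is a best action with its value (`none` when there is no layer). Apart from sampling, decoding
and accumulating a sample costs one step per bit plus one, and comparing the values of the actions
costs one step per action. -/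
def lookahead (γ : ℝ) (n m l fuel : ℕ) : ℕ → Belief kS → Run (Option (Bits kA × ℝ))
  | 0, _ => pure none
  | h + 1, b => do
      let qs ← Run.mapList (fun a => do
        let rs ← Run.times (D.slice b a).directSample n
        Run.tick (n * (kR + 1))
        let os ← Run.times (D.slice b a).directSample m
        Run.tick (m * (kO + 1))
        let vs ← (if h = 0 then pure [] else Run.mapList (fun o => do
          Run.record (D.obsProb b a o)
          let b' ← D.beliefUpdate l fuel b a o
          let best ← lookahead γ n m l fuel h b'
          pure (o, (best.map Prod.snd).getD 0)) D.observations.toList)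
        Run.tick 1
        let q : ℝ := (rs.map fun x => D.rewardValue (rewOf x)).sum / n +
          γ * ((os.map fun x => (List.lookup (obsOf x) vs).getD 0).sum / m)
        pure (a, q)) D.actions.toList
      pure (List.argmax (fun q : Bits kA × ℝ => q.2) qs)

end DDN

/-! ### Sample numbers -/

/-- The effective horizon `Γ = 1 / (1 - γ)`. -/
def effHorizon (γ : ℝ) : ℝ := (1 - γ)⁻¹

/-- The number of observation samples, `m = (γ Γ)² n`, rounded up. -/
def obsSamples (γ : ℝ) (n : ℕ) : ℕ := ⌈(γ * effHorizon γ) ^ 2 * (n : ℝ)⌉₊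

/-- The number of belief samples, rounded up. The sum over `k` is
`((γ S) ^ H - 1) / (γ S - 1)`, also when `γ S = 1`. -/
def beliefSamples (γ S R O : ℝ) (H n : ℕ) : ℕ :=
  ⌈(1 / 4 * ((R + γ * effHorizon γ * O) / (S - 1)) *
    (S / (effHorizon γ * (1 - γ ^ H)) * (∑ k ∈ Finset.range H, (γ * S) ^ k) - 1)) ^ 2 * (n : ℝ)⌉₊

/-- The failure probability allowed to each sampling operation, for overall failure probability `δ`
up to time `T`. -/
def failProb (A O δ : ℝ) (T H : ℕ) : ℝ :=
  δ * ((A * O) ^ H)⁻¹ *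
    (2 + A * ((T : ℝ) + 4 + A * O * (((H : ℝ) - 1) / (A * O - 1) ^ 2)))⁻¹

/-- The least number of reward samples prescribed for the accuracy `ε` and the confidence `1 - δ` up
to the stopping time `T`. -/
def rewardSamples (γ rmax S A O ε δ : ℝ) (T H : ℕ) : ℕ :=
  ⌈1 / 2 * Real.log (2 / failProb A O δ T H) *
    (rmax / (ε - 2 * γ ^ H * effHorizon γ * rmax) * (8 * effHorizon γ + 4 * S ^ T)) ^ 2⌉₊

namespace DDN

variable {kS kA kO kR : ℕ} (D : DDN kS kA kO kR)

/-- The quantum-classical lookahead algorithm with horizon `H` and `n` reward samples per node, from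
the belief `b`; every sampling loop is cut off after `fuel` attempts. -/
def algorithm (γ : ℝ) (n H fuel : ℕ) (b : Belief kS) : Run (Option (Bits kA × ℝ)) :=
  D.lookahead γ n (obsSamples γ n) (beliefSamples γ D.sizeS D.sizeR D.sizeO H n) fuel H b

/-- The expected running time of the algorithm (the running time of the algorithm with cut-off
increases to that of the algorithm without cut-off). -/
def expectedTime (γ : ℝ) (n H : ℕ) (b : Belief kS) : ℝ≥0∞ :=
  ⨆ fuel : ℕ, (D.algorithm γ n H fuel b).expect fun w => (w.1 : ℝ≥0∞)

/-- The expectation of `q_l`, the sum of `p ^ (-1/2)` over all observation probabilities `p` in the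
lookahead tree (with `0 ^ (-1/2) = ∞`). -/
def expectedQl (γ : ℝ) (n H : ℕ) (b : Belief kS) : ℝ≥0∞ :=
  ⨆ fuel : ℕ, (D.algorithm γ n H fuel b).expect fun w =>
    (w.2.map fun p => ENNReal.ofReal p ^ (-(1 / 2) : ℝ)).sum

end DDN

end QBRL

end

/-!
The running time is accounted for run by run. `QBRL.Run.TimeBound K x c` says that the expected time
of the computation `x` is at most `c + K * E[q]`, where `q` is the sum of `p ^ (-1/2)` over the
probabilities recorded by `x`; it is stable under sequential composition and loops. In the
lookahead, the direct sampling at the `∑ j < H, (A Ω) ^ j ≤ 2 (A Ω) ^ (H - 1)` belief nodes makes up `c`, and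
every belief update is paid by the observation probability `p` that is recorded just before it
(`QBRL.DDN.timeBound_lookahead`). The cut-off only removes work and recorded probabilities together,
so the comparison holds for every `fuel`, and passes to the suprema.

What remains is that quantum rejection sampling for evidence of probability `p` takes an expected
number `O(p ^ (-1/2))` of iterations (`QBRL.BayesNet.time_quantumSample_le`). The encoding circuit
maps `|0…0⟩` to the state with the amplitudes `√P(x)` (`QBRL.BayesNet.encode_apply_zeroState`), the
phase flips act as reflections on states with clean ancillas (`QBRL.BayesNet.phaseFlip_apply`), and
so the amplification operator is, up to its sign, a rotation by `2 θ` with `sin² θ = p`: after `k`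
steps the evidence is measured with probability `sin² ((2 k + 1) θ)`
(`QBRL.BayesNet.success_amplified`). Averaged over `k < m` this is at least `1/4` as soon as
`m ≥ p ^ (-1/2)` (`QBRL.quarter_le_sum_sin_sq`). As the range `m` grows by the factor `6/5` per
attempt, the costs before that moment form a geometric sum of order `p ^ (-1/2)`, and those after it
a series with the ratio `(3/4) (6/5) < 1`. One iteration costs `O(N 2 ^ M) = O(κ N M)` gates.

The rest is arithmetic of the sample numbers: `m = O(n)`,
`l = O(((R + Ω) S ^ (H - 1)) ^ 2 n)` (`QBRL.beliefSamples_le`), and for the second part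
`n = O((S ^ T / ε) ^ 2 log (…))` (`QBRL.rewardSamples_pos_and_le`).
-/

namespace QBRL

/-! ### Expected cost of randomized computations -/

theorem tsum_pmf_bind_mul {α β : Type} (p : PMF α) (f : α → PMF β) (g : β → ℝ≥0∞) :
    ∑' b, p.bind f b * g b = ∑' a, p a * ∑' b, f a b * g b := by
  simp_rw [PMF.bind_apply, ← ENNReal.tsum_mul_right, ← ENNReal.tsum_mul_left]
  rw [ENNReal.tsum_comm]
  simp_rw [mul_assoc]

theorem tsum_pmf_pure_mul {α : Type} (a : α) (g : α → ℝ≥0∞) :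
    ∑' b, PMF.pure a b * g b = g a := by
  rw [tsum_eq_single a]
  · simp
  · intro b hb
    simp [hb]

theorem tsum_pmf_map_mul {α β : Type} (p : PMF α) (h : α → β) (g : β → ℝ≥0∞) :
    ∑' b, p.map h b * g b = ∑' a, p a * g (h a) := by
  rw [← PMF.bind_pure_comp, tsum_pmf_bind_mul]
  simp

namespace Run

variable {α β : Type}

/-- Expectation of `F` over the results of the runs that are not cut off. -/
noncomputable def expectResult (x : Run α) (F : α → ℝ≥0∞) : ℝ≥0∞ :=
  ∑' w : Option α × Log, (show PMF (Option α × Log) from x) w * w.1.elim 0 F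

theorem expectResult_mono (x : Run α) {F G : α → ℝ≥0∞} (h : ∀ a, F a ≤ G a) :
    x.expectResult F ≤ x.expectResult G := by
  refine ENNReal.tsum_le_tsum fun w => mul_le_mul_right ?_ _
  cases w.1 with
  | none => exact le_rfl
  | some a => exact h a

theorem expectResult_const_le (x : Run α) (c : ℝ≥0∞) : x.expectResult (fun _ => c) ≤ c := by
  calc x.expectResult (fun _ => c)
      ≤ ∑' w : Option α × Log, (show PMF (Option α × Log) from x) w * c := by
        refine ENNReal.tsum_le_tsum fun w => mul_le_mul_right ?_ _
        cases w.1 <;> simp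
    _ = c := by rw [ENNReal.tsum_mul_right, PMF.tsum_coe, one_mul]

theorem expectResult_add (x : Run α) (F G : α → ℝ≥0∞) :
    x.expectResult (fun a => F a + G a) = x.expectResult F + x.expectResult G := by
  unfold expectResult
  rw [← ENNReal.tsum_add]
  refine tsum_congr fun w => ?_
  rw [← mul_add]
  cases w.1 <;> simp

theorem expectResult_const_mul (x : Run α) (c : ℝ≥0∞) (F : α → ℝ≥0∞) :
    x.expectResult (fun a => c * F a) = c * x.expectResult F := by
  unfold expectResult
  rw [← ENNReal.tsum_mul_left]
  refine tsum_congr fun w => ?_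
  cases w.1 <;> simp [mul_left_comm]

/-- The expectation of an additive function of the log splits along a sequential composition. -/
theorem expect_bind (x : Run α) (f : α → Run β) (g : Log → ℝ≥0∞)
    (hg : ∀ u v, g (u + v) = g u + g v) :
    (x >>= f).expect g = x.expect g + x.expectResult fun a => (f a).expect g := by
  have h0 : (x >>= f).expect g = ∑' w : Option β × Log,
      PMF.bind (show PMF (Option α × Log) from x) (fun w =>
        match w.1 with
        | none => PMF.pure (none, w.2)
        | some a => PMF.map (fun u : Option β × Log => (u.1, w.2 + u.2)) (f a)) w * g w.2 := rfl
  rw [h0, tsum_pmf_bind_mul (g := fun w : Option β × Log => g w.2)]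
  unfold expect expectResult
  rw [← ENNReal.tsum_add]
  refine tsum_congr fun w => ?_
  rw [← mul_add]
  congr 1
  obtain ⟨o, u⟩ := w
  cases o with
  | none => simp
  | some a =>
      have h1 : ∀ q : PMF (Option β × Log),
          ∑' v, PMF.map (fun v : Option β × Log => (v.1, u + v.2)) q v * g v.2 =
            g u + ∑' v, q v * g v.2 := by
        intro q
        rw [tsum_pmf_map_mul (g := fun w : Option β × Log => g w.2)]
        simp only [hg, mul_add]
        rw [ENNReal.tsum_add, ENNReal.tsum_mul_right, PMF.tsum_coe, one_mul]
      exact h1 (f a)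

theorem expect_pure (a : α) (g : Log → ℝ≥0∞) : (pure a : Run α).expect g = g 0 :=
  tsum_pmf_pure_mul (some a, (0 : Log)) fun w => g w.2

theorem expect_tick (c : ℕ) (g : Log → ℝ≥0∞) : (tick c).expect g = g (c, 0) :=
  tsum_pmf_pure_mul (some (), ((c, 0) : Log)) fun w => g w.2

theorem expect_record (p : ℝ) (g : Log → ℝ≥0∞) : (record p).expect g = g (0, {p}) :=
  tsum_pmf_pure_mul (some (), ((0, {p}) : Log)) fun w => g w.2

theorem expect_cut (g : Log → ℝ≥0∞) : (cut : Run α).expect g = g 0 :=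
  tsum_pmf_pure_mul ((none : Option α), (0 : Log)) fun w => g w.2

theorem expect_draw (μ : PMF α) (g : Log → ℝ≥0∞) : (draw μ).expect g = g 0 := by
  refine (tsum_pmf_map_mul μ (fun a => (some a, (0 : Log))) fun w => g w.2).trans ?_
  simp only
  rw [ENNReal.tsum_mul_right, PMF.tsum_coe, one_mul]

theorem expectResult_tick (c : ℕ) (F : Unit → ℝ≥0∞) : (tick c).expectResult F = F () :=
  tsum_pmf_pure_mul (some (), ((c, 0) : Log)) fun w => w.1.elim 0 F

theorem expectResult_record (p : ℝ) (F : Unit → ℝ≥0∞) : (record p).expectResult F = F () :=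
  tsum_pmf_pure_mul (some (), ((0, {p}) : Log)) fun w => w.1.elim 0 F

theorem expectResult_draw (μ : PMF α) (F : α → ℝ≥0∞) :
    (draw μ).expectResult F = ∑' a, μ a * F a :=
  tsum_pmf_map_mul μ (fun a => (some a, (0 : Log))) fun w => w.1.elim 0 F

/-- Expected number of elementary steps. -/
noncomputable def time (x : Run α) : ℝ≥0∞ := x.expect fun w => (w.1 : ℝ≥0∞)

/-- Expected sum of `p ^ (-1/2)` over the recorded probabilities `p`. -/
noncomputable def difficulty (x : Run α) : ℝ≥0∞ :=
  x.expect fun w => (w.2.map fun p => ENNReal.ofReal p ^ (-(1 / 2) : ℝ)).sum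

theorem time_bind (x : Run α) (f : α → Run β) :
    (x >>= f).time = x.time + x.expectResult fun a => (f a).time :=
  expect_bind x f _ fun u v => by simp

theorem difficulty_bind (x : Run α) (f : α → Run β) :
    (x >>= f).difficulty = x.difficulty + x.expectResult fun a => (f a).difficulty :=
  expect_bind x f _ fun u v => by simp

theorem time_tick_bind (c : ℕ) (f : Unit → Run β) :
    (tick c >>= f).time = c + (f ()).time := by
  rw [time_bind, expectResult_tick, time, expect_tick]

theorem time_draw_bind (μ : PMF α) (f : α → Run β) :
    (draw μ >>= f).time = ∑' a, μ a * (f a).time := by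
  rw [time_bind, expectResult_draw, time, expect_draw]
  simp

/-- The expected running time of `x` is at most a fixed part `c` plus `K` times the expected sum of
`p ^ (-1/2)` over the probabilities that `x` records. -/
def TimeBound (K : ℝ≥0∞) (x : Run α) (c : ℝ≥0∞) : Prop := x.time ≤ c + K * x.difficulty

variable {K : ℝ≥0∞}

theorem TimeBound.mono {x : Run α} {c d : ℝ≥0∞} (h : TimeBound K x c) (hcd : c ≤ d) :
    TimeBound K x d := h.trans (by gcongr)

theorem TimeBound.time_le {x : Run α} {c : ℝ≥0∞} (h : TimeBound 0 x c) : x.time ≤ c := by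
  simpa [TimeBound] using h

theorem timeBound_of_le {x : Run α} {c : ℝ≥0∞} (h : x.time ≤ c) : TimeBound K x c :=
  h.trans le_self_add

theorem timeBound_pure (a : α) : TimeBound K (pure a) 0 :=
  timeBound_of_le (by simp [time, expect_pure])

theorem timeBound_tick (c : ℕ) : TimeBound K (tick c) c :=
  timeBound_of_le (by simp [time, expect_tick])

theorem timeBound_draw (μ : PMF α) : TimeBound K (draw μ) 0 :=
  timeBound_of_le (by simp [time, expect_draw])

theorem TimeBound.bind {x : Run α} {f : α → Run β} {c d : ℝ≥0∞} (hx : TimeBound K x c)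
    (hf : ∀ a, TimeBound K (f a) d) : TimeBound K (x >>= f) (c + d) := by
  unfold TimeBound at *
  rw [time_bind, difficulty_bind]
  calc x.time + x.expectResult (fun a => (f a).time)
      ≤ (c + K * x.difficulty) + (d + K * x.expectResult fun a => (f a).difficulty) := by
        refine add_le_add hx ((expectResult_mono x hf).trans ?_)
        rw [expectResult_add, expectResult_const_mul]
        gcongr
        exact expectResult_const_le x d
    _ = c + d + K * (x.difficulty + x.expectResult fun a => (f a).difficulty) := by ring

/-- A computation `y` whose cost is covered by the probability recorded before it. -/
theorem TimeBound.record_bind {p : ℝ} {y : Run α} {f : α → Run β} {d : ℝ≥0∞}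
    (hy : y.time ≤ K * ENNReal.ofReal p ^ (-(1 / 2) : ℝ)) (hf : ∀ a, TimeBound K (f a) d) :
    TimeBound K (record p >>= fun _ => y >>= f) d := by
  unfold TimeBound at *
  rw [time_bind, difficulty_bind, expectResult_record, expectResult_record, time_bind,
    difficulty_bind, time, expect_record, difficulty, expect_record]
  have h1 : y.expectResult (fun a => (f a).time) ≤
      d + K * y.expectResult fun a => (f a).difficulty := by
    refine (expectResult_mono y hf).trans ?_
    rw [expectResult_add, expectResult_const_mul]
    gcongr
    exact expectResult_const_le y d
  simp only [Nat.cast_zero, zero_add, Multiset.map_singleton, Multiset.sum_singleton]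
  calc y.time + y.expectResult (fun a => (f a).time)
      ≤ K * ENNReal.ofReal p ^ (-(1 / 2) : ℝ) +
          (d + K * y.expectResult fun a => (f a).difficulty) := add_le_add hy h1
    _ = d + K * (ENNReal.ofReal p ^ (-(1 / 2) : ℝ) +
          (0 + y.expectResult fun a => (f a).difficulty)) := by ring
    _ ≤ _ := by gcongr; exact zero_le

theorem TimeBound.mapList {f : α → Run β} {c : ℝ≥0∞} (hf : ∀ a, TimeBound K (f a) c) :
    ∀ l : List α, TimeBound K (Run.mapList f l) (l.length * c)
  | [] => (timeBound_pure _).mono (by simp)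
  | a :: as => by
      refine ((hf a).bind fun y => (TimeBound.mapList hf as).bind fun ys =>
        timeBound_pure _).mono (le_of_eq ?_)
      push_cast [List.length_cons]
      ring

theorem TimeBound.times {x : Run α} {c : ℝ≥0∞} (hx : TimeBound K x c) :
    ∀ k : ℕ, TimeBound K (Run.times x k) (k * c)
  | 0 => (timeBound_pure _).mono (by simp)
  | k + 1 => by
      refine (hx.bind fun y => (TimeBound.times hx k).bind fun ys =>
        timeBound_pure _).mono (le_of_eq ?_)
      push_cast
      ring

end Run

/-! ### Circuits as real orthogonal maps -/

section Circuits

variable {Q : Type} [DecidableEq Q]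

theorem Circuit.apply_append (c d : Circuit Q) (ψ : QState Q) :
    Circuit.apply (c ++ d) ψ = d.apply (c.apply ψ) := List.foldl_append

theorem Circuit.apply_cons (g : Gate Q) (c : Circuit Q) (ψ : QState Q) :
    Circuit.apply (g :: c) ψ = c.apply (g.apply ψ) := rfl

theorem Circuit.apply_singleton (g : Gate Q) (ψ : QState Q) :
    Circuit.apply [g] ψ = g.apply ψ := rfl

theorem Gate.apply_sub_mul (g : Gate Q) (φ χ : QState Q) (a : ℂ) :
    g.apply (fun y => φ y - a * χ y) = fun y => g.apply φ y - a * g.apply χ y := by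
  funext y
  cases g with
  | z q => by_cases h : y q = true <;> simp [Gate.apply, h]; ring
  | ry θ q => by_cases h : y q = true <;> simp [Gate.apply, h] <;> ring
  | _ => simp [Gate.apply]

theorem Circuit.apply_sub_mul (c : Circuit Q) (φ χ : QState Q) (a : ℂ) :
    c.apply (fun y => φ y - a * χ y) = fun y => c.apply φ y - a * c.apply χ y := by
  induction c generalizing φ χ with
  | nil => rfl
  | cons g c ih =>
      simp only [Circuit.apply_cons, Gate.apply_sub_mul]
      exact ih _ _

theorem Gate.apply_inv_apply (g : Gate Q) (φ : QState Q) : g.apply (g.inv.apply φ) = φ := by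
  funext y
  cases g with
  | x q => simp [Gate.apply, Gate.inv, flipBit_flipBit]
  | z q => by_cases h : y q = true <;> simp [Gate.apply, Gate.inv, h]
  | cx c t => simp [Gate.apply, Gate.inv, toffoliMap_toffoliMap]
  | ccx c d t => simp [Gate.apply, Gate.inv, toffoliMap_toffoliMap]
  | ry θ q =>
      have hq : flipBit q y q = !y q := by simp [flipBit]
      have hcs : (Real.sin (θ / 2) : ℂ) ^ 2 + (Real.cos (θ / 2) : ℂ) ^ 2 = 1 := by
        exact_mod_cast Real.sin_sq_add_cos_sq (θ / 2)
      simp only [Gate.apply, Gate.inv, flipBit_flipBit, hq, neg_div, Real.cos_neg, Real.sin_neg,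
        Complex.ofReal_neg]
      generalize (Real.sin (θ / 2) : ℂ) = s at *
      generalize (Real.cos (θ / 2) : ℂ) = c at *
      cases y q <;> simp <;> linear_combination (φ y) * hcs

theorem Circuit.apply_inv_apply (c : Circuit Q) (φ : QState Q) : c.apply (c.inv.apply φ) = φ := by
  induction c generalizing φ with
  | nil => rfl
  | cons g c ih =>
      have h : Circuit.inv (g :: c) = Circuit.inv c ++ [g.inv] := by simp [Circuit.inv]
      rw [h, Circuit.apply_append, Circuit.apply_cons, Circuit.apply_singleton,
        Gate.apply_inv_apply, ih]

variable [Fintype Q]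

theorem sum_flip_mul_flip {f : (Q → Bool) → (Q → Bool)} (hf : Function.Involutive f)
    (φ χ : QState Q) : ∑ y, φ (f y) * χ y = ∑ y, φ y * χ (f y) :=
  Fintype.sum_equiv hf.toPerm _ _ fun y => by
    change _ = φ (f y) * χ (f (f y))
    rw [hf y]

/-- All gates are real orthogonal matrices, so the transpose of a gate is its inverse. -/
theorem Gate.sum_inv_apply_mul (g : Gate Q) (φ χ : QState Q) :
    ∑ y, g.inv.apply φ y * χ y = ∑ y, φ y * g.apply χ y := by
  cases g with
  | x q => exact sum_flip_mul_flip (flipBit_flipBit q) φ χ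
  | z q =>
      refine Finset.sum_congr rfl fun y _ => ?_
      by_cases h : y q = true <;> simp [Gate.apply, Gate.inv, h]
  | cx c t => exact sum_flip_mul_flip (toffoliMap_toffoliMap c c t) φ χ
  | ccx c d t => exact sum_flip_mul_flip (toffoliMap_toffoliMap c d t) φ χ
  | ry θ q =>
      have h1 := sum_flip_mul_flip (flipBit_flipBit q) φ
        (fun y => (if y q then -(Real.sin (θ / 2) : ℂ) else (Real.sin (θ / 2) : ℂ)) * χ y)
      have h2 : ∀ y : Q → Bool, (flipBit q y) q = !y q := fun y => by simp [flipBit]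
      simp only [Gate.apply, Gate.inv, neg_div, Real.cos_neg, Real.sin_neg, Complex.ofReal_neg,
        add_mul, mul_add, Finset.sum_add_distrib]
      congr 1
      · exact Finset.sum_congr rfl fun y _ => by ring
      · refine Eq.trans (Finset.sum_congr rfl fun y _ => ?_)
          (h1.trans (Finset.sum_congr rfl fun y _ => ?_))
        · cases y q <;> simp <;> ring
        · rw [h2]
          cases y q <;> simp

theorem Circuit.sum_inv_apply_mul (c : Circuit Q) (φ χ : QState Q) :
    ∑ y, c.inv.apply φ y * χ y = ∑ y, φ y * c.apply χ y := by
  induction c generalizing φ χ with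
  | nil => rfl
  | cons g c ih =>
      have h : Circuit.inv (g :: c) = Circuit.inv c ++ [g.inv] := by simp [Circuit.inv]
      rw [h, Circuit.apply_append, Circuit.apply_singleton, Gate.sum_inv_apply_mul, ih,
        Circuit.apply_cons]

end Circuits

namespace BayesNet

variable {V : Type} [DecidableEq V]

/-! ### The encoding circuit prepares the square root of the joint distribution -/

/-- The rotation of the qubit `t` by the angle `ϑ y`, which may depend on the basis state `y`. -/
noncomputable def rotate {Q : Type} [DecidableEq Q] (t : Q) (ϑ : (Q → Bool) → ℝ) (ψ : QState Q) :
    QState Q := fun y =>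
  (Real.cos (ϑ y / 2) : ℂ) * ψ y +
    (if y t then (Real.sin (ϑ y / 2) : ℂ) else -(Real.sin (ϑ y / 2) : ℂ)) * ψ (flipBit t y)

theorem uniformlyControlledRy_apply (t : V) (cs : List V) (ht : t ∉ cs) (θ : (V → Bool) → ℝ)
    (ψ : QState (V ⊕ Option V)) :
    (uniformlyControlledRy t cs θ).apply ψ =
      rotate (Sum.inl t) (fun y => θ fun u => if u ∈ cs then y (Sum.inl u) else false) ψ := by
  induction cs generalizing θ ψ with
  | nil => rfl
  | cons c cs ih =>
      have htc : c ≠ t := fun h => ht (by simp [h])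
      have htcs : t ∉ cs := fun h => ht (by simp [h])
      have hic : (Sum.inl c : V ⊕ Option V) ≠ Sum.inl t := fun h => htc (Sum.inl.inj h)
      funext y
      simp only [uniformlyControlledRy, Circuit.apply_append, Circuit.apply_singleton, ih htcs]
      -- the controls do not contain the target, so flipping the target leaves the angle unchanged
      have hflip : ∀ z : V ⊕ Option V → Bool,
          (fun u => if u ∈ cs then flipBit (Sum.inl t) z (Sum.inl u) else false) =
            fun u => if u ∈ cs then z (Sum.inl u) else false := by
        intro z
        funext u
        by_cases hu : u ∈ cs
        · have : (Sum.inl u : V ⊕ Option V) ≠ Sum.inl t :=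
            fun h => htcs (Sum.inl.inj h ▸ hu)
          simp [flipBit, Function.update_of_ne this]
        · simp [hu]
      have hrestr : (fun u => if u ∈ c :: cs then y (Sum.inl u) else false) =
          Function.update (fun u => if u ∈ cs then y (Sum.inl u) else false) c (y (Sum.inl c)) := by
        funext u
        by_cases hu : u = c
        · subst hu; simp
        · simp [hu]
      have hfc : ∀ z : V ⊕ Option V → Bool,
          flipBit (Sum.inl t) z (Sum.inl c) = z (Sum.inl c) := fun z => by
        simp [flipBit, Function.update_of_ne hic]
      have hft : ∀ z : V ⊕ Option V → Bool,
          flipBit (Sum.inl t) z (Sum.inl t) = !z (Sum.inl t) := fun z => by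
        simp [flipBit]
      simp only [rotate, Gate.apply, hrestr]
      set x : V → Bool := fun u => if u ∈ cs then y (Sum.inl u) else false with hx
      have htm : ∀ z : V ⊕ Option V → Bool, toffoliMap (Sum.inl c) (Sum.inl c) (Sum.inl t) z =
          if z (Sum.inl c) = true then flipBit (Sum.inl t) z else z := by
        intro z
        simp [toffoliMap, hic]
      have e1 : θ (Function.update x c false) / 2 =
          (θ (Function.update x c false) + θ (Function.update x c true)) / 2 / 2 +
          (θ (Function.update x c false) - θ (Function.update x c true)) / 2 / 2 := by ring
      have e2 : θ (Function.update x c true) / 2 =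
          (θ (Function.update x c false) + θ (Function.update x c true)) / 2 / 2 -
          (θ (Function.update x c false) - θ (Function.update x c true)) / 2 / 2 := by ring
      cases hc : y (Sum.inl c)
      · simp only [htm, hc, hfc, hft, hflip, flipBit_flipBit, Bool.false_eq_true, if_false, ← hx]
        rw [e1, Real.cos_add, Real.sin_add]
        generalize (θ (Function.update x c false) + θ (Function.update x c true)) / 2 / 2 = u
        generalize (θ (Function.update x c false) - θ (Function.update x c true)) / 2 / 2 = v
        cases y (Sum.inl t) <;> simp <;> ring
      · simp only [htm, hc, hfc, hft, hflip, flipBit_flipBit, if_true, ← hx]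
        rw [e2, Real.cos_sub, Real.sin_sub]
        generalize (θ (Function.update x c false) + θ (Function.update x c true)) / 2 / 2 = u
        generalize (θ (Function.update x c false) - θ (Function.update x c true)) / 2 / 2 = v
        cases y (Sum.inl t) <;> simp <;> ring

theorem factor_nonneg (B : BayesNet V) (v : V) (x : V → Bool) : 0 ≤ B.factor v x := by
  unfold factor
  split_ifs
  · exact (B.cpt v x).2.1
  · exact sub_nonneg.2 (B.cpt v x).2.2

theorem joint_nonneg [Fintype V] (B : BayesNet V) (x : V → Bool) : 0 ≤ B.joint x :=
  Finset.prod_nonneg fun v _ => B.factor_nonneg v x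

theorem factor_congr (B : BayesNet V) (v : V) (x y : V → Bool) (hv : x v = y v)
    (h : ∀ u ∈ B.parents v, x u = y u) : B.factor v x = B.factor v y := by
  unfold factor
  rw [hv, B.cpt_congr v x y h]

theorem not_mem_parents_self (B : BayesNet V) (v : V) : v ∉ B.parents v :=
  fun h => lt_irrefl _ (B.parents_before v v h)

/-- In the topological order, no variable is a parent of, or equal to, an earlier one. -/
theorem order_pairwise (B : BayesNet V) :
    B.order.Pairwise fun u v => v ∉ B.parents u ∧ v ≠ u := by
  rw [List.pairwise_iff_getElem]
  intro i j hi hj hij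
  have h1 := B.order_nodup.idxOf_getElem i hi
  have h2 := B.order_nodup.idxOf_getElem j hj
  refine ⟨fun h => ?_, fun h => ?_⟩
  · have := B.parents_before _ _ h
    omega
  · rw [h] at h2
    omega

/-- The state after the variables of an initial segment `L` of the order have been encoded. -/
theorem encode_prefix_apply [Fintype V] (B : BayesNet V) (L : List V)
    (hL : L.Pairwise fun u v => v ∉ B.parents u ∧ v ≠ u) :
    Circuit.apply (L.flatMap fun v => uniformlyControlledRy v (B.parents v).toList
        fun x => 2 * Real.arcsin (Real.sqrt (B.cpt v x))) zeroState =
      fun y => if (∀ v, v ∉ L → y (Sum.inl v) = false) ∧ ∀ o, y (Sum.inr o) = false then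
        (((L.map fun v => Real.sqrt (B.factor v fun u => y (Sum.inl u))).prod : ℝ) : ℂ)
      else 0 := by
  induction L using List.reverseRecOn with
  | nil =>
      funext y
      simp [Circuit.apply, zeroState]
  | append_singleton L v ih =>
      rw [List.pairwise_append] at hL
      obtain ⟨hL1, -, hL2⟩ := hL
      have hLv : ∀ u ∈ L, v ∉ B.parents u ∧ v ≠ u := fun u hu => hL2 u hu v (by simp)
      have hvL : v ∉ L := fun h => (hLv v h).2 rfl
      rw [List.flatMap_append, Circuit.apply_append, ih hL1, List.flatMap_singleton,
        uniformlyControlledRy_apply _ _ (by simpa using B.not_mem_parents_self v)]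
      funext y
      have hcpt : B.cpt v (fun u => if u ∈ (B.parents v).toList then y (Sum.inl u) else false) =
          B.cpt v fun u => y (Sum.inl u) :=
        B.cpt_congr _ _ _ fun u hu => by simp [hu]
      have hfr : ∀ o, flipBit (Sum.inl v) y (Sum.inr o) = y (Sum.inr o) := fun o => by
        simp [flipBit]
      have hfv : flipBit (Sum.inl v) y (Sum.inl v) = !y (Sum.inl v) := by simp [flipBit]
      have hfu : ∀ u, u ≠ v → flipBit (Sum.inl v) y (Sum.inl u) = y (Sum.inl u) := fun u hu => by
        have : (Sum.inl u : V ⊕ Option V) ≠ Sum.inl v := fun h => hu (Sum.inl.inj h)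
        simp [flipBit, Function.update_of_ne this]
      have hprod : (L.map fun w => Real.sqrt (B.factor w fun u =>
            flipBit (Sum.inl v) y (Sum.inl u))).prod =
          (L.map fun w => Real.sqrt (B.factor w fun u => y (Sum.inl u))).prod := by
        congr 1
        refine List.map_congr_left fun w hw => ?_
        rw [B.factor_congr w _ _ (hfu w (hLv w hw).2.symm)
          fun u hu => hfu u fun h => (hLv w hw).1 (h ▸ hu)]
      have hp0 : (0 : ℝ) ≤ B.cpt v fun u => y (Sum.inl u) := (B.cpt v _).2.1
      have hp1 : (B.cpt v fun u => y (Sum.inl u) : ℝ) ≤ 1 := (B.cpt v _).2.2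
      have hfac : B.factor v (fun u => y (Sum.inl u)) = if y (Sum.inl v) then
          (B.cpt v (fun u => y (Sum.inl u)) : ℝ) else 1 - B.cpt v (fun u => y (Sum.inl u)) := rfl
      simp only [rotate, hcpt, mul_div_cancel_left₀ _ (two_ne_zero (α := ℝ)), hfr, hprod,
        List.map_append, List.prod_append, List.map_singleton, List.prod_singleton, hfac]
      generalize (B.cpt v (fun u => y (Sum.inl u)) : ℝ) = p at *
      have hs : Real.sin (Real.arcsin (Real.sqrt p)) = Real.sqrt p :=
        Real.sin_arcsin (by linarith [Real.sqrt_nonneg p]) (Real.sqrt_le_one.2 hp1)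
      have hc : Real.cos (Real.arcsin (Real.sqrt p)) = Real.sqrt (1 - p) := by
        rw [Real.cos_arcsin, Real.sq_sqrt hp0]
      rw [hs, hc]
      have h1 : (∀ u, u ∉ L ++ [v] → y (Sum.inl u) = false) ↔
          ∀ u, u ∉ L → u ≠ v → y (Sum.inl u) = false := by
        refine forall_congr' fun u => ?_
        simp
      simp only [h1]
      by_cases ho : ∀ o, y (Sum.inr o) = false
      swap
      · simp [ho]
      simp only [ho, implies_true, and_true]
      cases hyv : y (Sum.inl v)
      · have h2 : ¬ ∀ u, u ∉ L → flipBit (Sum.inl v) y (Sum.inl u) = false := fun h => by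
          have := h v hvL
          rw [hfv, hyv] at this
          simp at this
        have h3 : (∀ u, u ∉ L → y (Sum.inl u) = false) ↔
            ∀ u, u ∉ L → u ≠ v → y (Sum.inl u) = false :=
          ⟨fun h u hu _ => h u hu, fun h u hu => by
            by_cases huv : u = v
            · rw [huv, hyv]
            · exact h u hu huv⟩
        simp only [if_neg h2, h3]
        by_cases h : ∀ u, u ∉ L → u ≠ v → y (Sum.inl u) = false
        · simp only [if_pos h]; simp; ring
        · simp only [if_neg h]; simp
      · have h2 : ¬ ∀ u, u ∉ L → y (Sum.inl u) = false := fun h => by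
          have := h v hvL
          rw [hyv] at this
          simp at this
        have h3 : (∀ u, u ∉ L → flipBit (Sum.inl v) y (Sum.inl u) = false) ↔
            ∀ u, u ∉ L → u ≠ v → y (Sum.inl u) = false :=
          ⟨fun h u hu huv => hfu u huv ▸ h u hu, fun h u hu => by
            by_cases huv : u = v
            · rw [huv, hfv, hyv]; rfl
            · rw [hfu u huv]; exact h u hu huv⟩
        simp only [if_neg h2, h3]
        by_cases h : ∀ u, u ∉ L → u ≠ v → y (Sum.inl u) = false
        · simp only [if_pos h]; simp; ring
        · simp only [if_neg h]; simp

theorem encode_apply_zeroState [Fintype V] (B : BayesNet V) :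
    B.encode.apply zeroState = fun y => if ∀ o, y (Sum.inr o) = false then
      ((Real.sqrt (B.joint fun u => y (Sum.inl u)) : ℝ) : ℂ) else 0 := by
  unfold encode
  rw [B.encode_prefix_apply B.order B.order_pairwise]
  funext y
  have h1 : (∀ v, v ∉ B.order → y (Sum.inl v) = false) ↔ True :=
    iff_true_intro fun v hv => absurd (B.mem_order v) hv
  have h2 : (B.order.map fun v => Real.sqrt (B.factor v fun u => y (Sum.inl u))).prod =
      Real.sqrt (B.joint fun u => y (Sum.inl u)) := by
    have h3 : B.order.toFinset = Finset.univ := by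
      ext v
      simp [B.mem_order v]
    rw [← List.prod_toFinset _ B.order_nodup, h3, joint,
      Real.sqrt_prod _ fun v _ => B.factor_nonneg v _]
  simp only [h2, h1, true_and]

/-! ### Phase flips and states with clean ancillas -/

/-- The amplitudes vanish unless all ancillas are `0`. -/
def Clean (φ : QState (V ⊕ Option V)) : Prop := ∀ y, (∃ o, y (Sum.inr o) = true) → φ y = 0

/-- If the ancillas of the listed variables are `0`, the ladder flips the phase of the basis states
in which the ancilla `acc` and all listed bits are `1`. -/
theorem phaseLadder_apply (vs : List V) (hvs : vs.Nodup) (acc : Option V)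
    (hacc : ∀ v ∈ vs, acc ≠ some v) (φ : QState (V ⊕ Option V))
    (hφ : ∀ y, ∀ v ∈ vs, y (Sum.inr (some v)) = true → φ y = 0) :
    (phaseLadder acc vs).apply φ = fun y =>
      if y (Sum.inr acc) = true ∧ ∀ v ∈ vs, y (Sum.inl v) = true then -φ y else φ y := by
  induction vs generalizing acc φ with
  | nil =>
      funext y
      simp [phaseLadder, Circuit.apply, Gate.apply]
  | cons v vs ih =>
      obtain ⟨hv, hvs⟩ := List.nodup_cons.1 hvs
      have hav : acc ≠ some v := hacc v (by simp)
      have htm : ∀ y : V ⊕ Option V → Bool,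
          toffoliMap (Sum.inr acc) (Sum.inl v) (Sum.inr (some v)) y =
            if y (Sum.inr acc) = true ∧ y (Sum.inl v) = true then
              flipBit (Sum.inr (some v)) y else y := by
        intro y
        simp [toffoliMap, hav]
      have hother : ∀ y : V ⊕ Option V → Bool, ∀ q, q ≠ Sum.inr (some v) →
          toffoliMap (Sum.inr acc) (Sum.inl v) (Sum.inr (some v)) y q = y q := by
        intro y q hq
        rw [htm]
        split_ifs
        · simp [flipBit, Function.update_of_ne hq]
        · rfl
      have htarget : ∀ y : V ⊕ Option V → Bool, y (Sum.inr (some v)) = false →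
          (toffoliMap (Sum.inr acc) (Sum.inl v) (Sum.inr (some v)) y (Sum.inr (some v)) = true ↔
            y (Sum.inr acc) = true ∧ y (Sum.inl v) = true) := by
        intro y hy
        rw [htm]
        split_ifs with h
        · simp [flipBit, hy, h]
        · simp [hy, h]
      funext y
      simp only [phaseLadder, Circuit.apply_append, Circuit.apply_singleton]
      rw [ih hvs (some v) (fun u hu h => hv (Option.some.inj h ▸ hu))]
      · simp only [Gate.apply, toffoliMap_toffoliMap]
        have hl : ∀ u : V, toffoliMap (Sum.inr acc) (Sum.inl v) (Sum.inr (some v)) y (Sum.inl u) =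
            y (Sum.inl u) := fun u => hother y _ (by simp)
        simp only [hl]
        cases hy : y (Sum.inr (some v))
        · simp only [htarget y hy, List.forall_mem_cons, and_assoc]
        · simp [hφ y v (by simp) hy]
      · intro z u hu hz
        refine hφ _ u (by simp [hu]) ?_
        rw [hother z _ fun h => hv (Option.some.inj (Sum.inr.inj h) ▸ hu)]
        exact hz

theorem apply_map_x (L : List V) (hL : L.Nodup) (φ : QState (V ⊕ Option V)) :
    Circuit.apply (L.map fun v => Gate.x (Sum.inl v)) φ =
      fun y => φ (Sum.elim (fun v => if v ∈ L then !y (Sum.inl v) else y (Sum.inl v))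
        fun o => y (Sum.inr o)) := by
  induction L generalizing φ with
  | nil =>
      funext y
      simp only [List.map_nil, List.not_mem_nil, if_false]
      change φ y = φ _
      congr 1
      funext q
      cases q <;> rfl
  | cons v L ih =>
      obtain ⟨hv, hL⟩ := List.nodup_cons.1 hL
      funext y
      rw [List.map_cons, Circuit.apply_cons, ih hL]
      simp only [Gate.apply]
      congr 1
      funext q
      rcases q with u | o
      · by_cases huv : u = v
        · subst huv; simp [flipBit, hv]
        · simp [flipBit, huv]
      · simp [flipBit]

theorem phaseFlip_apply (vs : List V) (hvs : vs.Nodup) (e : V → Bool)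
    (φ : QState (V ⊕ Option V)) (hφ : Clean φ) :
    (phaseFlip vs e).apply φ = fun y => if ∀ v ∈ vs, y (Sum.inl v) = e v then -φ y else φ y := by
  have hnd : (vs.filter fun v => !e v).Nodup := hvs.filter _
  funext y
  have hn : ∀ (z : V ⊕ Option V → Bool) q, q ≠ Sum.inr none → flipBit (Sum.inr none) z q = z q :=
    fun z q hq => by simp [flipBit, Function.update_of_ne hq]
  simp only [phaseFlip, Circuit.apply_append, Circuit.apply_singleton]
  rw [apply_map_x _ hnd]
  rw [phaseLadder_apply vs hvs none (by simp)]
  · simp only [Gate.apply, flipBit_flipBit, apply_map_x _ hnd, hn _ (Sum.inl _) (by simp),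
      Sum.elim_inl, Sum.elim_inr]
    have hback : (Sum.elim (fun v => if v ∈ vs.filter fun v => !e v then
          !(if v ∈ vs.filter fun v => !e v then !y (Sum.inl v) else y (Sum.inl v)) else
          (if v ∈ vs.filter fun v => !e v then !y (Sum.inl v) else y (Sum.inl v)))
        fun o => y (Sum.inr o)) = y := by
      funext q
      rcases q with v | o
      · by_cases h : v ∈ vs.filter fun v => !e v <;> simp only [Sum.elim_inl, h, if_true, if_false,
          Bool.not_not]
      · rfl
    have hcond : (∀ v ∈ vs, (if v ∈ vs.filter fun v => !e v then !y (Sum.inl v)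
        else y (Sum.inl v)) = true) ↔ ∀ v ∈ vs, y (Sum.inl v) = e v := by
      refine forall₂_congr fun v hv => ?_
      cases he : e v <;> simp [hv, he]
    rw [hback]
    simp only [hcond]
    cases hy : y (Sum.inr none)
    · simp [flipBit, hy]
    · simp [hφ y ⟨none, hy⟩]
  · intro z v _ hz
    simp only [Gate.apply, apply_map_x _ hnd]
    refine hφ _ ⟨some v, ?_⟩
    simpa [flipBit] using hz

/-- The gate acts on the qubits of the random variables only. -/
def ActsOnVars : Gate (V ⊕ Option V) → Prop
  | .x q | .z q | .ry _ q | .cx _ q | .ccx _ _ q => ∃ v, q = Sum.inl v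

theorem Clean.gate_apply {φ : QState (V ⊕ Option V)} (hφ : Clean φ) {g : Gate (V ⊕ Option V)}
    (hg : ActsOnVars g) : Clean (g.apply φ) := by
  rintro y ⟨o, ho⟩
  have hflip : ∀ v : V, φ (flipBit (Sum.inl v) y) = 0 := fun v =>
    hφ _ ⟨o, by simpa [flipBit] using ho⟩
  have htof : ∀ c d (v : V), φ (toffoliMap c d (Sum.inl v) y) = 0 := fun c d v => by
    unfold toffoliMap
    split_ifs
    exacts [hflip v, hφ y ⟨o, ho⟩]
  have hy := hφ y ⟨o, ho⟩
  cases g with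
  | x q => obtain ⟨v, rfl⟩ := hg; exact hflip v
  | z q => simp [Gate.apply, hy]
  | ry θ q => obtain ⟨v, rfl⟩ := hg; simp [Gate.apply, hy, hflip]
  | cx c q => obtain ⟨v, rfl⟩ := hg; exact htof _ _ v
  | ccx c d q => obtain ⟨v, rfl⟩ := hg; exact htof _ _ v

theorem Clean.circuit_apply {φ : QState (V ⊕ Option V)} (hφ : Clean φ)
    {c : Circuit (V ⊕ Option V)} (hc : ∀ g ∈ c, ActsOnVars g) : Clean (c.apply φ) := by
  induction c generalizing φ with
  | nil => exact hφ
  | cons g c ih =>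
      rw [Circuit.apply_cons]
      exact ih (hφ.gate_apply (hc g (by simp))) fun g' hg' => hc g' (by simp [hg'])

theorem actsOnVars_uniformlyControlledRy (t : V) (cs : List V) (θ : (V → Bool) → ℝ) :
    ∀ g ∈ uniformlyControlledRy t cs θ, ActsOnVars g := by
  induction cs generalizing θ with
  | nil =>
      intro g hg
      rw [uniformlyControlledRy, List.mem_singleton] at hg
      subst hg
      exact ⟨t, rfl⟩
  | cons c cs ih =>
      intro g hg
      simp only [uniformlyControlledRy, List.mem_append, List.mem_singleton] at hg
      rcases hg with ((hg | rfl) | hg) | rfl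
      exacts [ih _ g hg, ⟨t, rfl⟩, ih _ g hg, ⟨t, rfl⟩]

theorem actsOnVars_encode_inv (B : BayesNet V) : ∀ g ∈ B.encode.inv, ActsOnVars g := by
  intro g hg
  simp only [Circuit.inv, encode, List.mem_reverse, List.mem_map, List.mem_flatMap] at hg
  obtain ⟨g', ⟨v, -, hg'⟩, rfl⟩ := hg
  have h := actsOnVars_uniformlyControlledRy _ _ _ g' hg'
  cases g' <;> exact h

/-! ### Amplitude amplification -/

variable [Fintype V]

/-- The encoding state with its amplitudes multiplied by `α` on the basis states that match the
evidence, and by `β` on the other ones. -/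
noncomputable def planeState (B : BayesNet V) (ev : List V) (e : V → Bool) (α β : ℝ) :
    QState (V ⊕ Option V) := fun y =>
  if ∀ v ∈ ev, y (Sum.inl v) = e v then α * B.encode.apply zeroState y
  else β * B.encode.apply zeroState y

/-- The probability of the evidence. -/
noncomputable def evidenceProb (B : BayesNet V) (ev : List V) (e : V → Bool) : ℝ :=
  ∑ x : V → Bool, if ∀ v ∈ ev, x v = e v then B.joint x else 0

theorem clean_encode (B : BayesNet V) : Clean (B.encode.apply zeroState) := by
  rintro y ⟨o, ho⟩
  rw [encode_apply_zeroState]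
  refine if_neg fun h => ?_
  simp [h o] at ho

theorem clean_planeState (B : BayesNet V) (ev : List V) (e : V → Bool) (α β : ℝ) :
    Clean (B.planeState ev e α β) := fun y hy => by
  simp [planeState, B.clean_encode y hy]

/-- A sum over basis states that is carried by the clean ones is a sum over assignments. -/
theorem sum_encode_sq (B : BayesNet V) (c : (V → Bool) → ℝ) :
    ∑ y : V ⊕ Option V → Bool, (c fun v => y (Sum.inl v) : ℂ) * B.encode.apply zeroState y *
      B.encode.apply zeroState y = ((∑ x, c x * B.joint x : ℝ) : ℂ) := by
  rw [encode_apply_zeroState, ← (Equiv.sumArrowEquivProdArrow V (Option V) Bool).symm.sum_comp,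
    Fintype.sum_prod_type]
  push_cast
  refine Finset.sum_congr rfl fun x _ => ?_
  rw [Finset.sum_eq_single fun _ => false]
  · have h : (Real.sqrt (B.joint x) : ℂ) * Real.sqrt (B.joint x) = B.joint x := by
      exact_mod_cast Real.mul_self_sqrt (B.joint_nonneg x)
    simp [Equiv.sumArrowEquivProdArrow, mul_assoc, h]
  · intro z _ hz
    have : ¬ ∀ o, z o = false := fun h => hz (funext h)
    simp [Equiv.sumArrowEquivProdArrow, this]
  · simp

theorem normSq_encode (B : BayesNet V) (y : V ⊕ Option V → Bool) :
    (Complex.normSq (B.encode.apply zeroState y) : ℂ) =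
      B.encode.apply zeroState y * B.encode.apply zeroState y := by
  rw [encode_apply_zeroState]
  simp only
  split_ifs <;> simp [Complex.normSq_ofReal]

/-- The joint distribution has total mass `1`, because the encoding circuit is unitary. -/
theorem sum_joint (B : BayesNet V) : ∑ x, B.joint x = 1 := by
  have h1 := B.encode.sum_normSq_apply zeroState
  rw [sum_normSq_zeroState] at h1
  have h2 := B.sum_encode_sq fun _ => 1
  simp only [Complex.ofReal_one, one_mul] at h2
  simp only [← normSq_encode, ← Complex.ofReal_sum, h1] at h2
  exact (Complex.ofReal_inj.1 h2).symm

theorem evidenceProb_nonneg (B : BayesNet V) (ev : List V) (e : V → Bool) :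
    0 ≤ B.evidenceProb ev e :=
  Finset.sum_nonneg fun x _ => by split_ifs; exacts [B.joint_nonneg x, le_rfl]

theorem evidenceProb_le_one (B : BayesNet V) (ev : List V) (e : V → Bool) :
    B.evidenceProb ev e ≤ 1 := by
  rw [← B.sum_joint]
  exact Finset.sum_le_sum fun x _ => by split_ifs; exacts [le_rfl, B.joint_nonneg x]

/-- On the plane spanned by the matching and the non-matching part of the encoding state, `S_e` and
`B S₀ B†` are reflections. -/
theorem amplify_planeState (B : BayesNet V) (ev : List V) (hev : ev.Nodup) (e : V → Bool)
    (α β w : ℝ) (hwdef : w = -α * B.evidenceProb ev e + β * (1 - B.evidenceProb ev e)) :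
    (B.amplify ev e).apply (B.planeState ev e α β) =
      B.planeState ev e (-α - 2 * w) (β - 2 * w) := by
  set ψ := B.encode.apply zeroState with hψ
  have h1 : (phaseFlip ev e).apply (B.planeState ev e α β) = B.planeState ev e (-α) β := by
    rw [phaseFlip_apply ev hev e _ (B.clean_planeState ev e α β)]
    funext y
    simp only [planeState]
    split_ifs <;> push_cast <;> ring
  set φ := B.planeState ev e (-α) β with hφ
  set χ := B.encode.inv.apply φ with hχ
  have hclean : Clean χ := (B.clean_planeState ev e (-α) β).circuit_apply B.actsOnVars_encode_inv
  have hw : ∑ y, χ y * zeroState y = (w : ℂ) := by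
    rw [hχ, Circuit.sum_inv_apply_mul, ← hψ, hφ]
    have h2 := B.sum_encode_sq fun x => if ∀ v ∈ ev, x v = e v then -α else β
    have h3 : ∑ x, (if ∀ v ∈ ev, x v = e v then -α else β) * B.joint x = w := by
      have h4 : ∀ x, (if ∀ v ∈ ev, x v = e v then -α else β) * B.joint x =
          (-α - β) * (if ∀ v ∈ ev, x v = e v then B.joint x else 0) + β * B.joint x := by
        intro x
        split_ifs <;> ring
      rw [Finset.sum_congr rfl fun x _ => h4 x, Finset.sum_add_distrib, ← Finset.mul_sum,
        ← Finset.mul_sum, B.sum_joint]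
      rw [hwdef, evidenceProb]
      ring
    rw [← h3, ← h2]
    refine Finset.sum_congr rfl fun y _ => ?_
    simp only [planeState, ← hψ]
    split_ifs <;> ring
  have hw' : χ (fun _ => false) = w := by
    rw [← hw, Finset.sum_eq_single fun _ => false]
    · simp [zeroState]
    · intro y _ hy
      have : zeroState y = 0 := if_neg fun h => hy (funext h)
      rw [this, mul_zero]
    · simp
  have h5 : (phaseFlip B.order fun _ => false).apply χ =
      fun y => χ y - (2 * w : ℂ) * zeroState y := by
    rw [phaseFlip_apply B.order B.order_nodup _ χ hclean]
    funext y
    by_cases hy : ∀ q, y q = false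
    · have : y = fun _ => false := funext hy
      subst this
      simp only [hw', zeroState, implies_true, if_true]
      ring
    · have hz : zeroState y = 0 := if_neg hy
      by_cases hy' : ∃ o, y (Sum.inr o) = true
      · simp [hclean y hy', hz]
      · have hn : ¬ ∀ v ∈ B.order, y (Sum.inl v) = false := fun h => hy fun q => by
          rcases q with v | o
          · exact h v (B.mem_order v)
          · by_contra hne
            exact hy' ⟨o, by simpa using hne⟩
        simp [hn, hz]
  simp only [amplify, Circuit.apply_append, h1]
  rw [← hχ, h5, Circuit.apply_sub_mul, hχ, Circuit.apply_inv_apply]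
  funext y
  simp only [planeState, hφ, ← hψ]
  split_ifs <;> push_cast <;> ring

/-- With `sin² θ = P(e)`, the amplification operator is, up to the sign, the rotation of the plane
by the angle `2 θ`. The multipliers `α` and `β` are scaled by `sin θ` and `cos θ`, so that nothing
is divided by a sine or cosine which may vanish. -/
theorem amplified_apply (B : BayesNet V) (ev : List V) (hev : ev.Nodup) (e : V → Bool) {θ : ℝ}
    (hθ : Real.sin θ ^ 2 = B.evidenceProb ev e) (k : ℕ) :
    ∃ α β : ℝ, (B.amplified ev e k).apply zeroState = B.planeState ev e α β ∧
      α * Real.sin θ = (-1) ^ k * Real.sin ((2 * k + 1) * θ) ∧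
      β * Real.cos θ = (-1) ^ k * Real.cos ((2 * k + 1) * θ) := by
  induction k with
  | zero =>
      refine ⟨1, 1, ?_, by simp, by simp⟩
      funext y
      simp [amplified, planeState]
  | succ k ih =>
      obtain ⟨α, β, h, hα, hβ⟩ := ih
      have hs : B.amplified ev e (k + 1) = B.amplified ev e k ++ B.amplify ev e := by
        simp [amplified, List.replicate_succ', List.append_assoc]
      rw [hs, Circuit.apply_append, h, B.amplify_planeState ev hev e α β _ rfl]
      refine ⟨_, _, rfl, ?_, ?_⟩
      all_goals
        have hc : Real.cos θ ^ 2 = 1 - B.evidenceProb ev e := by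
          rw [← hθ, ← Real.sin_sq_add_cos_sq θ]; ring
        rw [← hc, ← hθ]
        have harg : (2 * ((k + 1 : ℕ) : ℝ) + 1) * θ = (2 * k + 1) * θ + 2 * θ := by
          push_cast; ring
        have hsc := Real.sin_sq_add_cos_sq θ
        rw [harg, pow_succ]
      · rw [Real.sin_add, Real.cos_two_mul, Real.sin_two_mul]
        linear_combination (-(2 * Real.cos θ ^ 2 - 1)) * hα -
          (2 * Real.sin θ * Real.cos θ) * hβ + 2 * α * Real.sin θ * hsc
      · rw [Real.cos_add, Real.cos_two_mul, Real.sin_two_mul]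
        linear_combination (-(2 * Real.cos θ ^ 2 - 1)) * hβ +
          (2 * Real.sin θ * Real.cos θ) * hα

/-- The success probability of an attempt with `k` amplification steps. -/
theorem success_amplified (B : BayesNet V) (ev : List V) (hev : ev.Nodup) (e : V → Bool) {θ : ℝ}
    (hθ : Real.sin θ ^ 2 = B.evidenceProb ev e) (k : ℕ) :
    ∑ y, (if ∀ v ∈ ev, y (Sum.inl v) = e v then
      Complex.normSq ((B.amplified ev e k).apply zeroState y) else 0) =
        Real.sin ((2 * k + 1) * θ) ^ 2 := by
  obtain ⟨α, β, h, hα, -⟩ := B.amplified_apply ev hev e hθ k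
  have h2 := B.sum_encode_sq fun x => if ∀ v ∈ ev, x v = e v then α ^ 2 else 0
  rw [h]
  have h3 : ∑ x, (if ∀ v ∈ ev, x v = e v then α ^ 2 else 0) * B.joint x =
      Real.sin ((2 * k + 1) * θ) ^ 2 := by
    have h4 : ∑ x, (if ∀ v ∈ ev, x v = e v then α ^ 2 else 0) * B.joint x =
        α ^ 2 * B.evidenceProb ev e := by
      rw [evidenceProb, Finset.mul_sum]
      exact Finset.sum_congr rfl fun x _ => by split_ifs <;> ring
    rw [h4, ← hθ, ← mul_pow, hα, mul_pow, ← pow_mul, mul_comm k 2, pow_mul]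
    simp
  rw [h3] at h2
  apply Complex.ofReal_injective
  rw [Complex.ofReal_sum, ← h2]
  refine Finset.sum_congr rfl fun y _ => ?_
  simp only [planeState]
  split_ifs
  · rw [Complex.normSq_mul, Complex.normSq_ofReal, Complex.ofReal_mul, normSq_encode]
    push_cast
    ring
  · simp

end BayesNet

/-! ### The average success probability of a randomized number of amplification steps -/

theorem sum_sin_sq_mul (θ : ℝ) (m : ℕ) :
    (∑ k ∈ Finset.range m, Real.sin ((2 * k + 1) * θ) ^ 2) * (4 * Real.sin (2 * θ)) =
      2 * m * Real.sin (2 * θ) - Real.sin (4 * m * θ) := by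
  induction m with
  | zero => simp
  | succ m ih =>
      rw [Finset.sum_range_succ, add_mul, ih]
      have h1 : 4 * ((m + 1 : ℕ) : ℝ) * θ = 2 * ((2 * m + 1) * θ) + 2 * θ := by push_cast; ring
      have h2 : 4 * (m : ℝ) * θ = 2 * ((2 * m + 1) * θ) - 2 * θ := by ring
      rw [h1, h2, Real.sin_add, Real.sin_sub, Real.cos_two_mul ((2 * m + 1) * θ)]
      have h3 := Real.sin_sq_add_cos_sq ((2 * (m : ℝ) + 1) * θ)
      push_cast
      linear_combination 4 * Real.sin (2 * θ) * h3

/-- If the number of amplification steps is uniform in `{0, …, m - 1}` and `m ≥ 1 / sin θ`, an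
attempt succeeds with probability at least `1/4`. -/
theorem quarter_le_sum_sin_sq {θ : ℝ} (h0 : 0 ≤ θ) (h1 : θ ≤ Real.pi / 2) {m : ℕ}
    (hm : 1 ≤ (m : ℝ) ^ 2 * Real.sin θ ^ 2) :
    (m : ℝ) / 4 ≤ ∑ k ∈ Finset.range m, Real.sin ((2 * k + 1) * θ) ^ 2 := by
  have hsum := sum_sin_sq_mul θ m
  set S := ∑ k ∈ Finset.range m, Real.sin ((2 * k + 1) * θ) ^ 2 with hS
  have hpi := Real.pi_pos
  have hm0 : (0 : ℝ) ≤ m := m.cast_nonneg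
  have hs0 : 0 ≤ Real.sin (2 * θ) := Real.sin_nonneg_of_nonneg_of_le_pi (by linarith) (by linarith)
  have hsc := Real.sin_sq_add_cos_sq θ
  have hlarge : 1 ≤ m * Real.sin (2 * θ) → (m : ℝ) / 4 ≤ S := by
    intro h
    have hpos : 0 < Real.sin (2 * θ) := by
      rcases hs0.eq_or_lt with h' | h'
      · rw [← h'] at h; norm_num at h
      · exact h'
    have := Real.sin_le_one (4 * m * θ)
    refine le_of_mul_le_mul_right ?_ (by positivity : 0 < 4 * Real.sin (2 * θ))
    linarith
  rcases le_or_gt (Real.sin θ ^ 2) (1 / 2) with hp | hp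
  · -- `sin² 2θ = 4 sin² θ (1 - sin² θ) ≥ 2 sin² θ`
    refine hlarge ?_
    have h2 : Real.sin (2 * θ) ^ 2 = 4 * Real.sin θ ^ 2 * (1 - Real.sin θ ^ 2) := by
      rw [Real.sin_two_mul]
      linear_combination 4 * Real.sin θ ^ 2 * hsc
    have h3 : Real.sin θ ^ 2 ≤ Real.sin (2 * θ) ^ 2 := by
      rw [h2]
      nlinarith [sq_nonneg (Real.sin θ)]
    have h4 : 1 ≤ (m * Real.sin (2 * θ)) ^ 2 := by
      rw [mul_pow]
      exact hm.trans (by gcongr)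
    exact (one_le_sq_iff₀ (by positivity)).1 h4
  · set φ := Real.pi / 2 - θ with hφ
    have hφ0 : 0 ≤ φ := by linarith
    have hφ1 : 2 * φ ≤ Real.pi / 2 := by
      by_contra hcon
      have h2 : Real.sin θ ≤ Real.sin (Real.pi / 4) :=
        Real.sin_le_sin_of_le_of_le_pi_div_two (by linarith) (by linarith) (by linarith)
      have h3 : 0 ≤ Real.sin θ := Real.sin_nonneg_of_nonneg_of_le_pi h0 (by linarith)
      have h4 : Real.sin θ ^ 2 ≤ Real.sin (Real.pi / 4) ^ 2 := by gcongr
      rw [Real.sin_pi_div_four, div_pow, Real.sq_sqrt (by norm_num)] at h4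
      linarith
    have e1 : Real.sin (2 * θ) = Real.sin (2 * φ) := by
      rw [← Real.sin_pi_sub]; congr 1; rw [hφ]; ring
    have e2 : Real.sin (4 * m * θ) = -Real.sin (4 * m * φ) := by
      have : 4 * (m : ℝ) * θ = m * (2 * Real.pi) - 4 * m * φ := by rw [hφ]; ring
      rw [this, Real.sin_nat_mul_two_pi_sub]
    rcases le_or_gt (4 * m * φ) Real.pi with h | h
    · rcases hs0.eq_or_lt with hz | hz
      · -- here `θ = π / 2`, and every attempt succeeds
        have hφz : φ = 0 := by
          by_contra hne
          have : 0 < Real.sin (2 * φ) := Real.sin_pos_of_pos_of_lt_pi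
            (by have := lt_of_le_of_ne hφ0 (Ne.symm hne); linarith) (by linarith)
          linarith
        have hθ : θ = Real.pi / 2 := by linarith
        have h5 : S = m := by
          rw [hS, Finset.sum_congr rfl fun k _ => ?_, Finset.sum_const, Finset.card_range,
            nsmul_eq_mul, mul_one]
          have : (2 * (k : ℝ) + 1) * θ = Real.pi / 2 + k * Real.pi := by rw [hθ]; ring
          rw [this, Real.sin_add_nat_mul_pi, Real.sin_pi_div_two, mul_one, ← pow_mul, mul_comm,
            pow_mul]
          simp
        linarith
      · have h2 : 0 ≤ Real.sin (4 * m * φ) :=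
          Real.sin_nonneg_of_nonneg_of_le_pi (by positivity) h
        refine le_of_mul_le_mul_right ?_ (by positivity : 0 < 4 * Real.sin (2 * θ))
        have := mul_nonneg hm0 hs0
        linarith
    · refine hlarge ?_
      have h2 := Real.mul_le_sin (by linarith : 0 ≤ 2 * φ) hφ1
      rw [e1]
      calc (1 : ℝ) ≤ 4 * m * φ / Real.pi := by rw [le_div_iff₀ hpi]; linarith
        _ = m * (2 / Real.pi * (2 * φ)) := by ring
        _ ≤ _ := by gcongr

namespace BayesNet

variable {V : Type} [DecidableEq V] [Fintype V]

/-! ### Expected cost of quantum rejection sampling -/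

/-- The number of elementary steps of an attempt with `k` amplification steps. -/
noncomputable def attemptCost (B : BayesNet V) (ev : List V) (e : V → Bool) (k : ℕ) : ℕ :=
  1 + Fintype.card (V ⊕ Option V) + (B.amplified ev e k).length + Fintype.card V + ev.length

theorem time_quantumSample_succ (B : BayesNet V) (ev : List V) (hev : ev.Nodup) (e : V → Bool)
    {c : ℝ} (hc : ∀ k, (B.attemptCost ev e k : ℝ) ≤ c * (k + 1)) {θ : ℝ}
    (hθ : Real.sin θ ^ 2 = B.evidenceProb ev e) (fuel r : ℕ) {W : ℝ} (hW : 0 ≤ W)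
    (hT : (B.quantumSample ev e fuel (r + 1)).time ≤ ENNReal.ofReal W) :
    (B.quantumSample ev e (fuel + 1) r).time ≤ ENNReal.ofReal (c * searchRange r +
      (1 - (∑ k ∈ Finset.range (searchRange r), Real.sin ((2 * k + 1) * θ) ^ 2) /
        searchRange r) * W) := by
  set m := searchRange r with hm
  have hm0 : (0 : ℝ) < m := by exact_mod_cast searchRange_pos r
  have hc0 : 0 ≤ c := by
    have := hc 0
    have h : (0 : ℝ) ≤ B.attemptCost ev e 0 := Nat.cast_nonneg _
    push_cast at this
    linarith
  have hs : ∀ k : ℕ, 0 ≤ 1 - Real.sin ((2 * k + 1) * θ) ^ 2 := fun k =>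
    sub_nonneg.2 (Real.sin_sq_le_one _)
  have hstep : (B.quantumSample ev e (fuel + 1) r).time =
      ∑' k, PMF.uniformOfFinset (Finset.range m)
        (Finset.nonempty_range_iff.2 (searchRange_pos r).ne') k *
      ((B.attemptCost ev e k : ℝ≥0∞) + ∑' y, Circuit.measure (B.amplified ev e k) y *
        (if ∀ v ∈ ev, y (Sum.inl v) = e v then (pure fun v => y (Sum.inl v) : Run (V → Bool))
          else B.quantumSample ev e fuel (r + 1)).time) := by
    rw [quantumSample, Run.time_draw_bind]
    refine tsum_congr fun k => ?_
    rw [Run.time_tick_bind, Run.time_draw_bind]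
    rfl
  have hk : ∀ k : ℕ, (B.attemptCost ev e k : ℝ≥0∞) +
      ∑' y, Circuit.measure (B.amplified ev e k) y *
        (if ∀ v ∈ ev, y (Sum.inl v) = e v then (pure fun v => y (Sum.inl v) : Run (V → Bool))
          else B.quantumSample ev e fuel (r + 1)).time ≤
      ENNReal.ofReal (c * (k + 1) + (1 - Real.sin ((2 * k + 1) * θ) ^ 2) * W) := by
    intro k
    rw [ENNReal.ofReal_add (by positivity) (mul_nonneg (hs k) hW)]
    refine add_le_add ?_ ?_
    · rw [← ENNReal.ofReal_natCast]
      exact ENNReal.ofReal_le_ofReal (hc k)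
    · have hsum : (1 - Real.sin ((2 * k + 1) * θ) ^ 2) * W =
          ∑ y, Complex.normSq ((B.amplified ev e k).apply zeroState y) *
            (if ∀ v ∈ ev, y (Sum.inl v) = e v then 0 else W) := by
        rw [← B.success_amplified ev hev e hθ k, ← sum_normSq_zeroState (Q := V ⊕ Option V),
          ← (B.amplified ev e k).sum_normSq_apply zeroState, ← Finset.sum_sub_distrib,
          Finset.sum_mul]
        exact Finset.sum_congr rfl fun y _ => by split_ifs <;> ring
      rw [hsum, ENNReal.ofReal_sum_of_nonneg fun y _ => by
        split_ifs
        · simp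
        · exact mul_nonneg (Complex.normSq_nonneg _) hW, tsum_fintype]
      refine Finset.sum_le_sum fun y _ => ?_
      rw [ENNReal.ofReal_mul (Complex.normSq_nonneg _)]
      refine mul_le_mul_right ?_ _
      split_ifs
      · simp [Run.time, Run.expect_pure]
      · exact hT
  rw [hstep]
  calc _ ≤ ∑' k, PMF.uniformOfFinset (Finset.range m)
          (Finset.nonempty_range_iff.2 (searchRange_pos r).ne') k *
        ENNReal.ofReal (c * (k + 1) + (1 - Real.sin ((2 * k + 1) * θ) ^ 2) * W) :=
        ENNReal.tsum_le_tsum fun k => mul_le_mul_right (hk k) _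
    _ = ∑ k ∈ Finset.range m, ENNReal.ofReal ((m : ℝ)⁻¹ *
          (c * (k + 1) + (1 - Real.sin ((2 * k + 1) * θ) ^ 2) * W)) := by
        rw [tsum_eq_sum (s := Finset.range m)]
        · refine Finset.sum_congr rfl fun k hk => ?_
          rw [PMF.uniformOfFinset_apply_of_mem _ hk, Finset.card_range,
            ENNReal.ofReal_mul (by positivity), ENNReal.ofReal_inv_of_pos hm0,
            ENNReal.ofReal_natCast]
        · intro k hk
          rw [PMF.uniformOfFinset_apply_of_notMem _ hk, zero_mul]
    _ = ENNReal.ofReal (∑ k ∈ Finset.range m, (m : ℝ)⁻¹ *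
          (c * (k + 1) + (1 - Real.sin ((2 * k + 1) * θ) ^ 2) * W)) := by
        rw [ENNReal.ofReal_sum_of_nonneg]
        intro k _
        have := mul_nonneg (hs k) hW
        positivity
    _ ≤ _ := by
        refine ENNReal.ofReal_le_ofReal ?_
        have h1 : ∑ k ∈ Finset.range m, c * ((k : ℝ) + 1) ≤ m * (c * m) := by
          have : ∀ k ∈ Finset.range m, c * ((k : ℝ) + 1) ≤ c * m := fun k hk => by
            have : (k : ℝ) + 1 ≤ m := by exact_mod_cast Finset.mem_range.1 hk
            gcongr
          simpa using Finset.sum_le_sum this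
        have h2 : ∑ k ∈ Finset.range m, (1 - Real.sin ((2 * k + 1) * θ) ^ 2) * W =
            (m - ∑ k ∈ Finset.range m, Real.sin ((2 * k + 1) * θ) ^ 2) * W := by
          rw [← Finset.sum_mul, Finset.sum_sub_distrib]
          simp
        rw [← Finset.mul_sum, Finset.sum_add_distrib, h2]
        calc _ ≤ (m : ℝ)⁻¹ * (m * (c * m) +
              (m - ∑ k ∈ Finset.range m, Real.sin ((2 * k + 1) * θ) ^ 2) * W) := by gcongr
          _ = _ := by
            rw [mul_add, inv_mul_cancel_left₀ hm0.ne', ← mul_assoc, mul_sub,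
              inv_mul_cancel₀ hm0.ne', div_eq_inv_mul]

theorem searchRange_le (r : ℕ) : (searchRange r : ℝ) ≤ 2 * (6 / 5 : ℝ) ^ r := by
  have h1 : (searchRange r : ℝ) < (6 / 5 : ℝ) ^ r + 1 := Nat.ceil_lt_add_one (by positivity)
  have h2 : (1 : ℝ) ≤ (6 / 5 : ℝ) ^ r := one_le_pow₀ (by norm_num)
  linarith

/-- Bound for the expected cost from attempt `r` on. While `(6/5) ^ r < q = P(e) ^ (-1/2)` the costs
of the attempts grow geometrically. Afterwards an attempt fails with probability at most `3/4`, and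
since `(3/4) (6/5) < 1` the remaining costs form a convergent geometric series. -/
noncomputable def remainingCost (c q : ℝ) (r : ℕ) : ℝ :=
  if q ≤ (6 / 5 : ℝ) ^ r then 20 * c * (6 / 5 : ℝ) ^ r
  else 36 * c * q - 10 * c * (6 / 5 : ℝ) ^ r

theorem remainingCost_of_le {c q : ℝ} {r : ℕ} (h : q ≤ (6 / 5 : ℝ) ^ r) :
    remainingCost c q r = 20 * c * (6 / 5 : ℝ) ^ r := if_pos h

theorem remainingCost_of_lt {c q : ℝ} {r : ℕ} (h : (6 / 5 : ℝ) ^ r < q) :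
    remainingCost c q r = 36 * c * q - 10 * c * (6 / 5 : ℝ) ^ r := if_neg (not_le.2 h)

theorem remainingCost_nonneg {c q : ℝ} (hc : 0 ≤ c) (r : ℕ) : 0 ≤ remainingCost c q r := by
  unfold remainingCost
  split_ifs with h
  · positivity
  · have : (6 / 5 : ℝ) ^ r ≤ q := (not_le.1 h).le
    have h0 : (0 : ℝ) ≤ (6 / 5 : ℝ) ^ r := by positivity
    nlinarith

theorem time_quantumSample_le_remainingCost (B : BayesNet V) (ev : List V) (hev : ev.Nodup)
    (e : V → Bool) {c : ℝ} (hc : ∀ k, (B.attemptCost ev e k : ℝ) ≤ c * (k + 1))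
    (hp : 0 < B.evidenceProb ev e) (fuel r : ℕ) :
    (B.quantumSample ev e fuel r).time ≤
      ENNReal.ofReal (remainingCost c (Real.sqrt (B.evidenceProb ev e))⁻¹ r) := by
  have hc0 : 0 ≤ c := by
    have := hc 0
    have h : (0 : ℝ) ≤ B.attemptCost ev e 0 := Nat.cast_nonneg _
    push_cast at this
    linarith
  set p := B.evidenceProb ev e with hpdef
  induction fuel generalizing r with
  | zero => simp [quantumSample, Run.time, Run.expect_cut]
  | succ fuel ih =>
      have hsq : Real.sqrt p ≤ 1 := Real.sqrt_le_one.2 (B.evidenceProb_le_one ev e)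
      have hsq0 : 0 < Real.sqrt p := Real.sqrt_pos.2 hp
      have hθ : Real.sin (Real.arcsin (Real.sqrt p)) ^ 2 = p := by
        rw [Real.sin_arcsin (by linarith) hsq, Real.sq_sqrt hp.le]
      refine (B.time_quantumSample_succ ev hev e hc hθ fuel r (remainingCost_nonneg hc0 _)
        (ih (r + 1))).trans (ENNReal.ofReal_le_ofReal ?_)
      set q := (Real.sqrt p)⁻¹ with hq
      set θ := Real.arcsin (Real.sqrt p)
      set S := ∑ k ∈ Finset.range (searchRange r), Real.sin ((2 * k + 1) * θ) ^ 2 with hS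
      have hm0 : (0 : ℝ) < searchRange r := by exact_mod_cast searchRange_pos r
      have hW := remainingCost_nonneg (q := q) hc0 (r + 1)
      have hS0 : 0 ≤ S := Finset.sum_nonneg fun k _ => sq_nonneg _
      have hm2 := searchRange_le r
      have hx : (0 : ℝ) < (6 / 5 : ℝ) ^ r := by positivity
      have hcm : c * searchRange r ≤ c * (2 * (6 / 5 : ℝ) ^ r) := by gcongr
      by_cases h : q ≤ (6 / 5 : ℝ) ^ r
      · have h' : q ≤ (6 / 5 : ℝ) ^ (r + 1) :=
          h.trans (pow_le_pow_right₀ (by norm_num) (Nat.le_succ r))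
        have hqm : q ≤ searchRange r := h.trans (Nat.le_ceil _)
        have h1 : 1 ≤ (searchRange r : ℝ) ^ 2 * Real.sin θ ^ 2 := by
          rw [hθ]
          calc (1 : ℝ) = q ^ 2 * p := by
                rw [hq, inv_pow, Real.sq_sqrt hp.le, inv_mul_cancel₀ hp.ne']
            _ ≤ _ := by gcongr
        have h2 := quarter_le_sum_sin_sq (Real.arcsin_nonneg.2 hsq0.le)
          (Real.arcsin_le_pi_div_two _) h1
        have h3 : 1 - S / searchRange r ≤ 3 / 4 := by
          have : 1 / 4 ≤ S / searchRange r := by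
            rw [le_div_iff₀ hm0]
            linarith
          linarith
        have h4 := mul_le_mul_of_nonneg_right h3 hW
        rw [remainingCost_of_le h', pow_succ] at h4
        rw [remainingCost_of_le h, remainingCost_of_le h', pow_succ]
        refine (add_le_add hcm h4).trans (le_of_eq ?_)
        ring
      · have h3 : 1 - S / searchRange r ≤ 1 := sub_le_self 1 (div_nonneg hS0 hm0.le)
        have h4 := mul_le_mul_of_nonneg_right h3 hW
        have hxq : c * (6 / 5 : ℝ) ^ r ≤ c * q := by
          have := (not_le.1 h).le
          gcongr
        rw [one_mul] at h4
        refine (add_le_add hcm h4).trans ?_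
        rw [remainingCost_of_lt (not_le.1 h)]
        by_cases h' : q ≤ (6 / 5 : ℝ) ^ (r + 1)
        · rw [remainingCost_of_le h', pow_succ]
          linarith
        · rw [remainingCost_of_lt (not_le.1 h'), pow_succ]
          linarith

/-- Quantum rejection sampling takes an expected number of `O(P(e) ^ (-1/2))` iterations. -/
theorem time_quantumSample_le (B : BayesNet V) (ev : List V) (hev : ev.Nodup) (e : V → Bool)
    {c : ℝ≥0} (hc0 : 0 < c) (hc : ∀ k, (B.attemptCost ev e k : ℝ) ≤ c * (k + 1)) (fuel : ℕ) :
    (B.quantumSample ev e fuel 0).time ≤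
      36 * c * ENNReal.ofReal (B.evidenceProb ev e) ^ (-(1 / 2) : ℝ) := by
  rcases (B.evidenceProb_nonneg ev e).eq_or_lt with hp | hp
  · -- for impossible evidence the bound is `∞`
    rw [← hp, ENNReal.ofReal_zero, ENNReal.zero_rpow_of_neg (by norm_num), ENNReal.mul_top]
    · exact le_top
    · simp [hc0.ne']
  · refine (B.time_quantumSample_le_remainingCost ev hev e hc hp fuel 0).trans ?_
    have hq : 1 ≤ (Real.sqrt (B.evidenceProb ev e))⁻¹ :=
      (one_le_inv₀ (Real.sqrt_pos.2 hp)).2 (Real.sqrt_le_one.2 (B.evidenceProb_le_one ev e))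
    have h1 : remainingCost c (Real.sqrt (B.evidenceProb ev e))⁻¹ 0 ≤
        36 * c * (Real.sqrt (B.evidenceProb ev e))⁻¹ := by
      have hc' : (0 : ℝ) ≤ c := c.2
      unfold remainingCost
      split_ifs <;> nlinarith
    refine (ENNReal.ofReal_le_ofReal h1).trans (le_of_eq ?_)
    rw [ENNReal.ofReal_mul (by positivity), ENNReal.ofReal_mul (by norm_num),
      ENNReal.ofReal_coe_nnreal, ENNReal.ofReal_rpow_of_pos hp, Real.rpow_neg hp.le,
      Real.sqrt_eq_rpow]
    norm_num

/-! ### Sizes of the circuits -/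

theorem length_uniformlyControlledRy {V : Type} [DecidableEq V] (t : V) (cs : List V)
    (θ : (V → Bool) → ℝ) :
    (uniformlyControlledRy t cs θ).length + 2 = 3 * 2 ^ cs.length := by
  induction cs generalizing θ with
  | nil => rfl
  | cons c cs ih =>
      have h1 := ih fun x => (θ (Function.update x c false) + θ (Function.update x c true)) / 2
      have h2 := ih fun x => (θ (Function.update x c false) - θ (Function.update x c true)) / 2
      simp only [uniformlyControlledRy, List.length_append, List.length_cons,
        List.length_nil, pow_succ]
      omega

theorem card_parents_le (B : BayesNet V) (v : V) : (B.parents v).card ≤ B.maxParents :=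
  Finset.le_sup (f := fun v => (B.parents v).card) (Finset.mem_univ v)

theorem length_order (B : BayesNet V) : B.order.length = Fintype.card V := by
  have h : B.order.toFinset = Finset.univ := by
    ext v
    simp [B.mem_order v]
  rw [← List.toFinset_card_of_nodup B.order_nodup, h, Finset.card_univ]

theorem length_encode_le (B : BayesNet V) :
    B.encode.length ≤ Fintype.card V * (3 * 2 ^ B.maxParents) := by
  rw [encode, List.length_flatMap, ← B.length_order]
  refine (List.sum_le_card_nsmul _ (3 * 2 ^ B.maxParents) fun n hn => ?_).trans (by simp)
  obtain ⟨v, -, rfl⟩ := List.mem_map.1 hn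
  have h1 := length_uniformlyControlledRy v (B.parents v).toList
    fun x => 2 * Real.arcsin (Real.sqrt (B.cpt v x))
  have h2 : 2 ^ (B.parents v).toList.length ≤ 2 ^ B.maxParents := by
    rw [Finset.length_toList]
    exact Nat.pow_le_pow_right (by norm_num) (B.card_parents_le v)
  omega

theorem length_phaseLadder {V : Type} (acc : Option V) (vs : List V) :
    (phaseLadder acc vs).length = 2 * vs.length + 1 := by
  induction vs generalizing acc with
  | nil => rfl
  | cons v vs ih =>
      simp only [phaseLadder, List.length_append, List.length_nil, List.length_cons, ih]
      ring

theorem length_phaseFlip_le {V : Type} (vs : List V) (e : V → Bool) :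
    (phaseFlip vs e).length ≤ 4 * vs.length + 3 := by
  have h := List.length_filter_le (fun v => !e v) vs
  simp only [phaseFlip, List.length_append, List.length_map, List.length_singleton,
    length_phaseLadder]
  omega

theorem attemptCost_le (B : BayesNet V) (ev : List V) (hev : ev.Nodup) (e : V → Bool) (k : ℕ) :
    B.attemptCost ev e k ≤
      (6 * Fintype.card V * 2 ^ B.maxParents + 8 * Fintype.card V + 6) * (k + 1) := by
  have h1 := B.length_encode_le
  have h2 : ev.length ≤ Fintype.card V := by
    rw [← List.toFinset_card_of_nodup hev]
    exact Finset.card_le_univ _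
  have h3 := length_phaseFlip_le ev e
  have h4 := length_phaseFlip_le B.order fun _ => false
  rw [B.length_order] at h4
  have h5 : (B.amplify ev e).length ≤ 2 * B.encode.length + 8 * Fintype.card V + 6 := by
    simp only [amplify, Circuit.inv, List.length_append, List.length_reverse, List.length_map]
    omega
  have h6 : (B.amplified ev e k).length ≤
      B.encode.length + k * (2 * B.encode.length + 8 * Fintype.card V + 6) := by
    simp only [amplified, List.length_append, List.length_flatten, List.map_replicate,
      List.sum_replicate, smul_eq_mul]
    gcongr
  have h7 : attemptCost B ev e k ≤ 4 * Fintype.card V + 2 + B.encode.length +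
      k * (2 * B.encode.length + 8 * Fintype.card V + 6) := by
    simp only [attemptCost, Fintype.card_sum, Fintype.card_option]
    omega
  refine h7.trans ?_
  have h8 : 2 * B.encode.length + 8 * Fintype.card V + 6 ≤
      6 * Fintype.card V * 2 ^ B.maxParents + 8 * Fintype.card V + 6 := by
    linarith
  refine le_trans ?_ (Nat.mul_le_mul_right (k + 1) h8)
  linarith

theorem timeBound_directSampleFrom {K : ℝ≥0∞} (B : BayesNet V) (vs : List V) (x : V → Bool) :
    Run.TimeBound K (B.directSampleFrom vs x) (vs.length * (B.maxParents + 1)) := by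
  induction vs generalizing x with
  | nil => exact (Run.timeBound_pure x).mono (by simp)
  | cons v vs ih =>
      rw [directSampleFrom]
      refine ((Run.timeBound_tick _).bind fun _ => (Run.timeBound_draw _).bind fun y =>
        ih _).mono ?_
      have h : (((B.parents v).card + 1 : ℕ) : ℝ≥0∞) ≤ B.maxParents + 1 := by
        exact_mod_cast Nat.succ_le_succ (B.card_parents_le v)
      calc _ ≤ (B.maxParents + 1 : ℝ≥0∞) + (0 + vs.length * (B.maxParents + 1)) := by gcongr
        _ = _ := by push_cast [List.length_cons]; ring

theorem timeBound_directSample {K : ℝ≥0∞} (B : BayesNet V) :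
    Run.TimeBound K B.directSample (Fintype.card V * (B.maxParents + 1)) := by
  rw [← B.length_order]
  exact B.timeBound_directSampleFrom _ _

end BayesNet

namespace DDN

open Var

variable {kS kA kO kR : ℕ} (D : DDN kS kA kO kR)

/-! ### Expected cost of the lookahead -/

/-- The evidence `O_{t+1} = o`, as an assignment. -/
abbrev obsAssign (o : Bits kO) : Var kS kA kO kR → Bool :=
  Sum.elim (fun _ => false) (Sum.elim (fun _ => false)
    (Sum.elim (fun _ => false) (Sum.elim o (fun _ => false))))

/-- The variables of `O_{t+1}`. -/
abbrev obsVars (kS kA kO kR : ℕ) : List (Var kS kA kO kR) := (List.finRange kO).map obs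

theorem nodup_obsVars : (obsVars kS kA kO kR).Nodup :=
  (List.nodup_finRange kO).map fun i j h => by simpa using h

theorem evidenceProb_slice (b : Belief kS) (a : Bits kA) (o : Bits kO) :
    (D.slice b a).evidenceProb (obsVars kS kA kO kR) (obsAssign o) = D.obsProb b a o := by
  refine Finset.sum_congr rfl fun x _ => ?_
  have h : (∀ v ∈ obsVars kS kA kO kR, x v = obsAssign o v) ↔ obsOf x = o := by
    simp [funext_iff]
  simp only [h]

/-- A bound for the number of elementary steps of a sampling attempt, per amplification step. -/
def attemptUnit : ℕ := 6 * D.numVars * 2 ^ D.maxParents + 8 * D.numVars + 6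

theorem time_quantumSample_slice_le (b : Belief kS) (a : Bits kA) (o : Bits kO) (fuel : ℕ) :
    ((D.slice b a).quantumSample (obsVars kS kA kO kR) (obsAssign o) fuel 0).time ≤
      36 * D.attemptUnit * ENNReal.ofReal (D.obsProb b a o) ^ (-(1 / 2) : ℝ) := by
  have h := (D.slice b a).time_quantumSample_le (obsVars kS kA kO kR) nodup_obsVars (obsAssign o)
    (c := (D.attemptUnit : ℝ≥0)) (by
      have : 0 < D.attemptUnit := by unfold attemptUnit; omega
      exact_mod_cast this) (fun k => by
      exact_mod_cast (D.slice b a).attemptCost_le (obsVars kS kA kO kR) nodup_obsVars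
        (obsAssign o) k) fuel
  rw [evidenceProb_slice] at h
  exact_mod_cast h

theorem obsProb_le_one (b : Belief kS) (a : Bits kA) (o : Bits kO) : D.obsProb b a o ≤ 1 := by
  rw [← evidenceProb_slice]
  exact (D.slice b a).evidenceProb_le_one _ _

theorem one_le_obsProb_rpow (b : Belief kS) (a : Bits kA) (o : Bits kO) :
    1 ≤ ENNReal.ofReal (D.obsProb b a o) ^ (-(1 / 2) : ℝ) := by
  rw [ENNReal.rpow_neg, ENNReal.one_le_inv]
  exact ENNReal.rpow_le_one (ENNReal.ofReal_le_one.2 (D.obsProb_le_one b a o)) (by norm_num)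

/-- A bound for the cost of a belief update when the observation is certain. -/
def updateUnit (l : ℕ) : ℕ := kS * 2 ^ kS + l * (36 * D.attemptUnit) + l * kS

theorem time_beliefUpdate_le (l fuel : ℕ) (b : Belief kS) (a : Bits kA) (o : Bits kO) :
    (D.beliefUpdate l fuel b a o).time ≤
      D.updateUnit l * ENNReal.ofReal (D.obsProb b a o) ^ (-(1 / 2) : ℝ) := by
  have hq := D.time_quantumSample_slice_le b a o fuel
  have hp := D.one_le_obsProb_rpow b a o
  set q := ENNReal.ofReal (D.obsProb b a o) ^ (-(1 / 2) : ℝ)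
  have h : Run.TimeBound 0 (D.beliefUpdate l fuel b a o)
      ((kS * 2 ^ kS : ℕ) + (l * (36 * D.attemptUnit * q) + ((l * kS : ℕ) + 0))) := by
    unfold beliefUpdate
    exact (Run.timeBound_tick _).bind fun _ => (Run.TimeBound.times
      (Run.timeBound_of_le hq) l).bind fun xs => (Run.timeBound_tick _).bind fun _ =>
        Run.timeBound_pure _
  refine h.time_le.trans ?_
  calc _ ≤ ((kS * 2 ^ kS : ℕ) : ℝ≥0∞) * q + (l * (36 * D.attemptUnit * q) +
        (((l * kS : ℕ) : ℝ≥0∞) * q + 0)) := by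
        gcongr <;> exact le_mul_of_one_le_right zero_le hp
    _ = _ := by
        unfold updateUnit
        push_cast
        ring

/-- The cost of the classical part of the work for one belief and one action. -/
def classicalUnit (n m : ℕ) : ℕ :=
  n * (D.numVars * (D.maxParents + 1)) + n * (kR + 1) +
    (m * (D.numVars * (D.maxParents + 1)) + m * (kO + 1)) + 1

/-- The classical work is done at `∑ j < h, (A Ω) ^ j` belief nodes, and the cost of each belief
update is charged to the observation probability recorded before it. -/
theorem timeBound_lookahead (γ : ℝ) (n m l fuel h : ℕ) (b : Belief kS) :
    Run.TimeBound (D.updateUnit l) (D.lookahead γ n m l fuel h b)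
      (D.classicalUnit n m * D.sizeA * ∑ j ∈ Finset.range h, (D.sizeA * D.sizeO : ℝ≥0∞) ^ j) := by
  induction h generalizing b with
  | zero =>
      rw [lookahead]
      exact (Run.timeBound_pure _).mono zero_le
  | succ h ih =>
      rw [lookahead]
      have hds : ∀ a, Run.TimeBound (D.updateUnit l) (D.slice b a).directSample
          (D.numVars * (D.maxParents + 1)) := fun a => (D.slice b a).timeBound_directSample
      set T : ℝ≥0∞ := D.classicalUnit n m * D.sizeA *
        ∑ j ∈ Finset.range h, (D.sizeA * D.sizeO : ℝ≥0∞) ^ j with hT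
      refine ((Run.TimeBound.mapList (c := D.classicalUnit n m + D.sizeO * T)
        (fun a => ?_) _).bind fun _ => Run.timeBound_pure _).mono (le_of_eq ?_)
      · refine Run.TimeBound.mono (((hds a).times n).bind fun rs =>
          (Run.timeBound_tick _).bind fun _ => ((hds a).times m).bind fun os =>
          (Run.timeBound_tick _).bind fun _ => Run.TimeBound.bind (c := D.sizeO * T) ?_ fun vs =>
          (Run.timeBound_tick _).bind fun _ => Run.timeBound_pure _) (le_of_eq ?_)
        · split_ifs with h0
          · exact (Run.timeBound_pure _).mono zero_le
          · have hlen : (D.sizeO : ℝ≥0∞) = (D.observations.toList.length : ℝ≥0∞) := by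
              rw [Finset.length_toList]; rfl
            rw [hlen]
            refine Run.TimeBound.mapList (fun o => ?_) _
            exact Run.TimeBound.record_bind (D.time_beliefUpdate_le l fuel b a o) fun b' =>
              ((ih b').bind fun best => Run.timeBound_pure _).mono (by simp [hT])
        · unfold classicalUnit
          push_cast
          ring
      · have hlen : (D.actions.toList.length : ℝ≥0∞) = (D.sizeA : ℝ≥0∞) := by
          rw [Finset.length_toList]; rfl
        rw [hlen, geom_sum_succ, hT]
        ring

theorem expectedTime_le (γ : ℝ) (n H : ℕ) (b : Belief kS) :
    D.expectedTime γ n H b ≤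
      D.classicalUnit n (obsSamples γ n) * D.sizeA *
        ∑ j ∈ Finset.range H, (D.sizeA * D.sizeO : ℝ≥0∞) ^ j +
      D.updateUnit (beliefSamples γ D.sizeS D.sizeR D.sizeO H n) * D.expectedQl γ n H b := by
  refine iSup_le fun fuel => (D.timeBound_lookahead γ n _ _ fuel H b).trans ?_
  gcongr
  exact le_iSup (fun fuel => (D.algorithm γ n H fuel b).difficulty) fuel

/-! ### Bounds in terms of the size of the network -/

theorem kS_pos (hS : 2 ≤ D.sizeS) : 0 < kS := by
  rcases Nat.eq_zero_or_pos kS with h | h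
  · subst h
    have := Finset.card_le_univ D.states
    have h2 : Fintype.card (Bits 0) = 1 := by simp
    unfold sizeS at hS
    omega
  · exact h

theorem numVars_eq : D.numVars = kS + (kA + (kS + (kO + kR))) := by
  simp [numVars]

/-- The bits of `S_t` form a complete subnetwork, so the last one has `kS - 1` parents. -/
theorem kS_le_maxParents (hS : 2 ≤ D.sizeS) : kS ≤ D.maxParents + 1 := by
  have h0 := D.kS_pos hS
  have h1 := D.toBayesNet.card_parents_le (cur ⟨kS - 1, by omega⟩)
  rw [D.parents_cur, Finset.card_image_of_injective _ Sum.inl_injective] at h1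
  have h2 : (Finset.univ.filter fun j : Fin kS => j < ⟨kS - 1, by omega⟩).card = kS - 1 := by
    rw [Finset.filter_gt_eq_Iio]
    simp
  omega

theorem maxParents_pos_of_sparse {κ : ℝ≥0} (hκ : (2 : ℝ≥0) ^ D.maxParents ≤ κ * D.maxParents) :
    1 ≤ D.maxParents := by
  by_contra h
  have h0 : D.maxParents = 0 := by omega
  simp [h0] at hκ

theorem one_le_of_sparse {κ : ℝ≥0} (hκ : (2 : ℝ≥0) ^ D.maxParents ≤ κ * D.maxParents) :
    1 ≤ κ := by
  have hM : (0 : ℝ≥0) < D.maxParents := by exact_mod_cast D.maxParents_pos_of_sparse hκ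
  have h : (D.maxParents : ℝ≥0) ≤ 2 ^ D.maxParents := by
    exact_mod_cast Nat.lt_two_pow_self.le
  exact le_of_mul_le_mul_right (by rw [one_mul]; exact h.trans hκ) hM

theorem classicalUnit_le {κ : ℝ≥0} (hκ : (2 : ℝ≥0) ^ D.maxParents ≤ κ * D.maxParents)
    (hS : 2 ≤ D.sizeS) {n : ℕ} (hn : 1 ≤ n) (γ : ℝ) :
    (D.classicalUnit n (obsSamples γ n) : ℝ) ≤
      (7 + 3 * (γ * effHorizon γ) ^ 2) * κ * (n * D.numVars * D.maxParents) := by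
  have hM := D.maxParents_pos_of_sparse hκ
  have hκ1 : (1 : ℝ) ≤ κ := D.one_le_of_sparse hκ
  have hk := D.kS_pos hS
  have hN := D.numVars_eq
  set N := D.numVars
  set M := D.maxParents
  set m := obsSamples γ n with hm
  have hm1 : (m : ℝ) ≤ (γ * effHorizon γ) ^ 2 * n + 1 := (Nat.ceil_lt_add_one (by positivity)).le
  have h1 : N * (M + 1) ≤ 2 * (N * M) := by nlinarith
  have hNM : N ≤ N * M := Nat.le_mul_of_pos_right _ hM
  have h2 : kR + 1 ≤ N * M := by omega
  have h3 : kO + 1 ≤ N * M := by omega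
  have h4 : D.classicalUnit n m ≤ (3 * n + 3 * m + 1) * (N * M) := by
    calc D.classicalUnit n m ≤ n * (2 * (N * M)) + n * (N * M) +
          (m * (2 * (N * M)) + m * (N * M)) + 1 := by unfold classicalUnit; gcongr
      _ ≤ _ := by
          have : 1 ≤ N * M := by omega
          linarith
  have hn1 : (1 : ℝ) ≤ n := by exact_mod_cast hn
  calc (D.classicalUnit n m : ℝ) ≤ (3 * n + 3 * m + 1) * (N * M) := by exact_mod_cast h4
    _ ≤ ((7 + 3 * (γ * effHorizon γ) ^ 2) * n) * (N * M) := by gcongr; linarith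
    _ = (7 + 3 * (γ * effHorizon γ) ^ 2) * 1 * (n * N * M) := by ring
    _ ≤ _ := by gcongr

theorem updateUnit_le {κ : ℝ≥0} (hκ : (2 : ℝ≥0) ^ D.maxParents ≤ κ * D.maxParents)
    (hS : 2 ≤ D.sizeS) (l : ℕ) :
    (D.updateUnit l : ℝ) ≤ (2 + 721 * l) * (κ * (D.numVars * D.maxParents)) := by
  have hM := D.maxParents_pos_of_sparse hκ
  have hκ1 : (1 : ℝ) ≤ κ := D.one_le_of_sparse hκ
  have hk := D.kS_pos hS
  have hN := D.numVars_eq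
  have hkM := D.kS_le_maxParents hS
  have hκ' : (2 : ℝ) ^ D.maxParents ≤ κ * D.maxParents := by exact_mod_cast hκ
  unfold updateUnit attemptUnit
  set N := D.numVars
  set M := D.maxParents
  have hN1 : (1 : ℝ) ≤ N := by exact_mod_cast (by omega : 1 ≤ N)
  have hM1 : (1 : ℝ) ≤ M := by exact_mod_cast hM
  have hkN : (kS : ℝ) ≤ N := by exact_mod_cast (by omega : kS ≤ N)
  have h1 : (2 : ℝ) ^ kS ≤ 2 * (κ * M) := by
    calc (2 : ℝ) ^ kS ≤ 2 ^ (M + 1) := pow_le_pow_right₀ (by norm_num) hkM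
      _ ≤ _ := by rw [pow_succ]; linarith
  have h2 : (N : ℝ) ≤ κ * (N * M) := by
    calc (N : ℝ) = 1 * (N * 1) := by ring
      _ ≤ _ := by gcongr
  have h3 : (kS : ℝ) * 2 ^ kS ≤ N * (2 * (κ * M)) := by gcongr
  have h4 : 36 * (6 * (N : ℝ) * 2 ^ M + 8 * N + 6) ≤ 720 * (κ * (N * M)) := by
    have : (N : ℝ) * 2 ^ M ≤ N * (κ * M) := by gcongr
    linarith
  push_cast
  have hl : (0 : ℝ) ≤ l := l.cast_nonneg
  have h5 := mul_le_mul_of_nonneg_left h4 hl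
  have h6 := mul_le_mul_of_nonneg_left (hkN.trans h2) hl
  linarith

end DDN

/-! ### The sample numbers -/

theorem geom_sum_le_two_mul_pow {x : ℝ} (hx : 2 ≤ x) (h : ℕ) :
    ∑ j ∈ Finset.range (h + 1), x ^ j ≤ 2 * x ^ h := by
  induction h with
  | zero => norm_num
  | succ h ih =>
      rw [Finset.sum_range_succ, pow_succ]
      have : 0 < x ^ h := by positivity
      nlinarith

theorem beliefSamples_le {γ S R O : ℝ} (hγ0 : 0 < γ) (hγ1 : γ < 1) (hS : 2 ≤ S) (hR : 0 ≤ R)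
    (hO : 1 ≤ O) {H n : ℕ} (hH : 1 ≤ H) (hn : 1 ≤ n) :
    (beliefSamples γ S R O H n : ℝ) ≤
      (9 / 4 * (1 + γ * effHorizon γ) ^ 2 + 1) * (((R + O) * S ^ (H - 1)) ^ 2 * n) := by
  obtain ⟨h, rfl⟩ : ∃ h, H = h + 1 := ⟨H - 1, by omega⟩
  rw [Nat.add_sub_cancel]
  have hg : 0 < 1 - γ := by linarith
  have hΓ : 0 < effHorizon γ := inv_pos.2 hg
  have hγΓ : 0 < γ * effHorizon γ := mul_pos hγ0 hΓ
  set g := γ * effHorizon γ with hgdef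
  have hn1 : (1 : ℝ) ≤ n := by exact_mod_cast hn
  have hSh : 1 ≤ S ^ h := one_le_pow₀ (by linarith)
  set Y := (R + O) * S ^ h with hY
  have hY1 : 1 ≤ Y := one_le_mul_of_one_le_of_one_le (by linarith) hSh
  have hden : 1 ≤ effHorizon γ * (1 - γ ^ (h + 1)) := by
    have h1 : γ ^ (h + 1) ≤ γ := by
      rw [pow_succ]
      exact mul_le_of_le_one_left hγ0.le (pow_le_one₀ hγ0.le hγ1.le)
    calc (1 : ℝ) = effHorizon γ * (1 - γ) := (inv_mul_cancel₀ hg.ne').symm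
      _ ≤ _ := by gcongr
  have hsum : ∑ k ∈ Finset.range (h + 1), (γ * S) ^ k ≤ 2 * S ^ h := by
    refine le_trans (Finset.sum_le_sum fun k _ => ?_) (geom_sum_le_two_mul_pow hS h)
    gcongr
    exact mul_le_of_le_one_left (by linarith) hγ1.le
  have hsum0 : 0 ≤ ∑ k ∈ Finset.range (h + 1), (γ * S) ^ k :=
    Finset.sum_nonneg fun k _ => by positivity
  have hv1 : S / (effHorizon γ * (1 - γ ^ (h + 1))) * ∑ k ∈ Finset.range (h + 1), (γ * S) ^ k ≤
      S * (2 * S ^ h) := by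
    gcongr
    exact div_le_self (by linarith) hden
  have hv0 : 0 ≤ S / (effHorizon γ * (1 - γ ^ (h + 1))) *
      ∑ k ∈ Finset.range (h + 1), (γ * S) ^ k := by positivity
  set v := S / (effHorizon γ * (1 - γ ^ (h + 1))) * ∑ k ∈ Finset.range (h + 1), (γ * S) ^ k
  have hS1 : 0 < S - 1 := by linarith
  have hw : |1 / 4 * ((R + g * O) / (S - 1)) * (v - 1)| ≤ 3 / 2 * (1 + g) * Y := by
    have h1 : |v - 1| ≤ 3 * S * S ^ h := by
      have : 1 ≤ S * S ^ h := one_le_mul_of_one_le_of_one_le (by linarith) hSh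
      rw [abs_le]
      constructor <;> linarith
    have h2 : R + g * O ≤ (1 + g) * (R + O) := by nlinarith
    have h3 : S / (S - 1) ≤ 2 := by rw [div_le_iff₀ hS1]; linarith
    rw [abs_mul, abs_of_nonneg (by positivity : 0 ≤ 1 / 4 * ((R + g * O) / (S - 1)))]
    calc _ ≤ 1 / 4 * ((1 + g) * (R + O) / (S - 1)) * (3 * S * S ^ h) := by gcongr
      _ = 3 / 4 * (1 + g) * ((R + O) * S ^ h) * (S / (S - 1)) := by ring
      _ ≤ 3 / 4 * (1 + g) * ((R + O) * S ^ h) * 2 := by gcongr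
      _ = _ := by rw [hY]; ring
  have hw2 := sq_le_sq' (neg_le_of_abs_le hw) (le_of_abs_le hw)
  calc (beliefSamples γ S R O (h + 1) n : ℝ)
      ≤ (1 / 4 * ((R + g * O) / (S - 1)) * (v - 1)) ^ 2 * n + 1 :=
        (Nat.ceil_lt_add_one (by positivity)).le
    _ ≤ (3 / 2 * (1 + g) * Y) ^ 2 * n + Y ^ 2 * n := by
        gcongr
        exact one_le_mul_of_one_le_of_one_le (one_le_pow₀ hY1) hn1
    _ = _ := by ring

/-- The logarithm in the prescribed sample number is of the order of the one in the time bound,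
whose argument is at least `2`. -/
theorem log_two_div_failProb_le {A O δ : ℝ} (hA : 1 ≤ A) (hAO : 2 ≤ A * O) (hO : 1 ≤ O)
    (hδ0 : 0 < δ) (hδ1 : δ < 1) {T H : ℕ} (hT : 1 ≤ T) (hH : 1 ≤ H) :
    2 ≤ ((T : ℝ) + H / (A * O)) * (A ^ (H + 1) * O ^ H / δ) ∧
      1 < 2 / failProb A O δ T H ∧
      Real.log (2 / failProb A O δ T H) ≤
        5 * Real.log (((T : ℝ) + H / (A * O)) * (A ^ (H + 1) * O ^ H / δ)) := by
  set y := A * O with hy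
  have hT1 : (1 : ℝ) ≤ T := by exact_mod_cast hT
  have hH1 : (1 : ℝ) ≤ H := by exact_mod_cast hH
  set u := (T : ℝ) + H / y with hu
  have hyH : y ≤ y ^ H := le_self_pow₀ (by linarith) (by omega)
  have hX : u * (A ^ (H + 1) * O ^ H / δ) = A * u * (y ^ H / δ) := by
    rw [hy, mul_pow, pow_succ]; ring
  have hyδ : 2 ≤ y ^ H / δ := by
    rw [le_div_iff₀ hδ0]; nlinarith
  have hu1 : 1 ≤ u := by
    have : 0 ≤ (H : ℝ) / y := by positivity
    linarith
  have hAu : 1 ≤ A * u := one_le_mul_of_one_le_of_one_le hA hu1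
  rw [hX]
  have hX2 : 2 ≤ A * u * (y ^ H / δ) := by nlinarith
  set X := A * u * (y ^ H / δ) with hXdef
  -- `y / (y - 1)² ≤ 4 / y` for `y ≥ 2`
  have hfrac : y * (((H : ℝ) - 1) / (y - 1) ^ 2) ≤ 4 * (H / y) := by
    have hy1 : 0 < (y - 1) ^ 2 := by have : 0 < y - 1 := by linarith
                                     positivity
    have h1 : y * (H - 1) * y ≤ 4 * H * (y - 1) ^ 2 := by
      have h2 : y ^ 2 ≤ 4 * (y - 1) ^ 2 := by nlinarith
      nlinarith [mul_le_mul_of_nonneg_right h2 (by linarith : (0 : ℝ) ≤ H), sq_nonneg y]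
    rw [← mul_div_assoc, ← mul_div_assoc, div_le_div_iff₀ hy1 (by linarith)]
    linarith
  have hfrac0 : 0 ≤ y * (((H : ℝ) - 1) / (y - 1) ^ 2) :=
    mul_nonneg (by linarith) (div_nonneg (by linarith) (sq_nonneg _))
  set f := y * (((H : ℝ) - 1) / (y - 1) ^ 2) with hf
  have hfp : 2 / failProb A O δ T H = 2 * (2 + A * (T + 4 + f)) * (y ^ H / δ) := by
    unfold failProb
    rw [← hy, ← hf]
    have : 0 < 2 + A * (T + 4 + f) := by positivity
    field_simp
  have hle : 2 / failProb A O δ T H ≤ 14 * X := by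
    rw [hfp, hXdef, ← mul_assoc 14]
    refine mul_le_mul_of_nonneg_right ?_ (by linarith)
    have h1 : A * 1 ≤ A * T := by gcongr
    have h2 : A * f ≤ A * (4 * (H / y)) := by gcongr
    have h3 : 0 ≤ A * (H / y) := by positivity
    rw [hu]
    linarith
  have hge : 1 < 2 / failProb A O δ T H := by
    rw [hfp]
    have : 0 ≤ A * (T + 4 + f) := by positivity
    nlinarith
  refine ⟨hX2, hge, ?_⟩
  have h5 : 14 * X ≤ X ^ 5 := by
    have : (2 : ℝ) ^ 4 ≤ X ^ 4 := by gcongr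
    rw [pow_succ]
    gcongr
    linarith
  calc Real.log (2 / failProb A O δ T H) ≤ Real.log (X ^ 5) :=
        Real.log_le_log (by linarith) (hle.trans h5)
    _ = 5 * Real.log X := by rw [Real.log_pow]; norm_num

theorem rewardSamples_pos_and_le {γ rmax η S A O ε δ : ℝ} (hγ0 : 0 < γ) (hγ1 : γ < 1)
    (hr : 0 < rmax) (hη : η < 1) (hS : 1 ≤ S) (hA : 1 ≤ A) (hAO : 2 ≤ A * O) (hO : 1 ≤ O)
    (hδ0 : 0 < δ) (hδ1 : δ < 1) (hε : 0 < ε) (hε2 : ε ≤ 2 * effHorizon γ * rmax) {T H : ℕ}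
    (hT : 1 ≤ T) (hH : 1 ≤ H) (hη2 : 2 * γ ^ H * effHorizon γ * rmax ≤ η * ε) :
    1 ≤ rewardSamples γ rmax S A O ε δ T H ∧
    (rewardSamples γ rmax S A O ε δ T H : ℝ) ≤
      (5 / 2 * (rmax / (1 - η) * (8 * effHorizon γ + 4)) ^ 2 +
        2 * (2 * effHorizon γ * rmax) ^ 2) * ((S ^ T / ε) ^ 2 *
        Real.log (((T : ℝ) + H / (A * O)) * (A ^ (H + 1) * O ^ H / δ))) := by
  obtain ⟨hX2, hge, hlog⟩ := log_two_div_failProb_le hA hAO hO hδ0 hδ1 hT hH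
  set X := ((T : ℝ) + H / (A * O)) * (A ^ (H + 1) * O ^ H / δ)
  have hΓ : 0 < effHorizon γ := inv_pos.2 (by linarith)
  have hη1 : 0 < 1 - η := by linarith
  have hgap : (1 - η) * ε ≤ ε - 2 * γ ^ H * effHorizon γ * rmax := by linarith
  have hgap0 : 0 < (1 - η) * ε := by positivity
  have hST : 1 ≤ S ^ T := one_le_pow₀ hS
  have hlogX : 1 / 2 ≤ Real.log X :=
    le_trans (by linarith [Real.log_two_gt_d9]) (Real.log_le_log (by norm_num) hX2)
  have hlog0 : 0 < Real.log (2 / failProb A O δ T H) := Real.log_pos hge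
  have hbase : rmax / (ε - 2 * γ ^ H * effHorizon γ * rmax) * (8 * effHorizon γ + 4 * S ^ T) ≤
      rmax / (1 - η) * (8 * effHorizon γ + 4) * (S ^ T / ε) := by
    calc _ ≤ rmax / ((1 - η) * ε) * ((8 * effHorizon γ + 4) * S ^ T) := by
          gcongr
          nlinarith
      _ = _ := by
          field_simp
  have hbase0 : 0 < rmax / (ε - 2 * γ ^ H * effHorizon γ * rmax) *
      (8 * effHorizon γ + 4 * S ^ T) := by
    have : 0 < ε - 2 * γ ^ H * effHorizon γ * rmax := hgap0.trans_le hgap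
    positivity
  have hone : 1 ≤ 2 * (2 * effHorizon γ * rmax) ^ 2 * ((S ^ T / ε) ^ 2 * Real.log X) := by
    have h1 : 1 ≤ 2 * effHorizon γ * rmax * (S ^ T / ε) := by
      rw [← mul_div_assoc, le_div_iff₀ hε, one_mul]
      exact hε2.trans (le_mul_of_one_le_right (by positivity) hST)
    have h2 : 1 ≤ (2 * effHorizon γ * rmax * (S ^ T / ε)) ^ 2 := one_le_pow₀ h1
    calc (1 : ℝ) ≤ 2 * (2 * effHorizon γ * rmax * (S ^ T / ε)) ^ 2 * (1 / 2) := by linarith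
      _ ≤ 2 * (2 * effHorizon γ * rmax * (S ^ T / ε)) ^ 2 * Real.log X := by gcongr
      _ = _ := by ring
  refine ⟨?_, ?_⟩
  · exact Nat.ceil_pos.2 (by positivity)
  · calc (rewardSamples γ rmax S A O ε δ T H : ℝ)
        ≤ 1 / 2 * Real.log (2 / failProb A O δ T H) *
            (rmax / (ε - 2 * γ ^ H * effHorizon γ * rmax) *
              (8 * effHorizon γ + 4 * S ^ T)) ^ 2 + 1 :=
          (Nat.ceil_lt_add_one (by positivity)).le
      _ ≤ 1 / 2 * (5 * Real.log X) *
            (rmax / (1 - η) * (8 * effHorizon γ + 4) * (S ^ T / ε)) ^ 2 +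
            2 * (2 * effHorizon γ * rmax) ^ 2 * ((S ^ T / ε) ^ 2 * Real.log X) := by gcongr
      _ = _ := by ring

/-! ### The running time -/

theorem DDN.expectedTime_le_of_sparse {γ : ℝ} (hγ0 : 0 < γ) (hγ1 : γ < 1) {kS kA kO kR : ℕ}
    (D : DDN kS kA kO kR) (b : Belief kS) {κ : ℝ≥0} {n H : ℕ} (hS : 2 ≤ D.sizeS)
    (hAO : 2 ≤ D.sizeA * D.sizeO) (hn : 1 ≤ n) (hH : 1 ≤ H)
    (hκ : (2 : ℝ≥0) ^ D.maxParents ≤ κ * D.maxParents) {c₁ c₂ : ℝ≥0}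
    (hc₁ : (c₁ : ℝ) = 7 + 3 * (γ * effHorizon γ) ^ 2)
    (hc₂ : (c₂ : ℝ) = 9 / 4 * (1 + γ * effHorizon γ) ^ 2 + 1) :
    D.expectedTime γ n H b ≤ ((2 * c₁ + 721 * c₂ + 2 : ℝ≥0) : ℝ≥0∞) * κ *
      (n * D.numVars * D.maxParents * D.sizeA ^ (H - 1) * D.sizeO ^ (H - 1) *
        (D.sizeA + ((D.sizeR + D.sizeO) * D.sizeS ^ (H - 1)) ^ 2 * D.expectedQl γ n H b)) := by
  have hA1 : 1 ≤ D.sizeA := Nat.pos_of_ne_zero fun h => by simp [h] at hAO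
  have hO1 : 1 ≤ D.sizeO := Nat.pos_of_ne_zero fun h => by simp [h] at hAO
  have hcl : (D.classicalUnit n (obsSamples γ n) : ℝ≥0∞) ≤
      c₁ * κ * (n * D.numVars * D.maxParents) := by
    have h := D.classicalUnit_le hκ hS hn γ
    rw [← hc₁] at h
    exact_mod_cast h
  have hgeom : ∑ j ∈ Finset.range H, (D.sizeA * D.sizeO : ℝ≥0∞) ^ j ≤
      2 * (D.sizeA * D.sizeO : ℝ≥0∞) ^ (H - 1) := by
    obtain ⟨h, rfl⟩ : ∃ h, H = h + 1 := ⟨H - 1, by omega⟩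
    have h1 := geom_sum_le_two_mul_pow (x := ((D.sizeA * D.sizeO : ℕ) : ℝ))
      (by exact_mod_cast hAO) h
    have h2 : ∑ j ∈ Finset.range (h + 1), (D.sizeA * D.sizeO) ^ j ≤
        2 * (D.sizeA * D.sizeO) ^ h := by exact_mod_cast h1
    exact_mod_cast h2
  set Z : ℕ := ((D.sizeR + D.sizeO) * D.sizeS ^ (H - 1)) ^ 2 with hZ
  have hZn : 1 ≤ Z * n := by
    have : 0 < D.sizeS := by omega
    have : 0 < Z := by positivity
    exact Nat.mul_pos this hn
  have hup : (D.updateUnit (beliefSamples γ D.sizeS D.sizeR D.sizeO H n) : ℝ≥0∞) ≤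
      ((721 * c₂ + 2 : ℝ≥0) : ℝ≥0∞) * κ * (n * D.numVars * D.maxParents) * Z := by
    have h1 := beliefSamples_le (S := D.sizeS) (R := D.sizeR) (O := D.sizeO) hγ0 hγ1
      (by exact_mod_cast hS) (Nat.cast_nonneg _) (by exact_mod_cast hO1) hH hn
    have h2 := D.updateUnit_le hκ hS (beliefSamples γ D.sizeS D.sizeR D.sizeO H n)
    rw [← hc₂] at h1
    set l := beliefSamples γ D.sizeS D.sizeR D.sizeO H n
    have hZr : (1 : ℝ) ≤ Z * n := by exact_mod_cast hZn
    have h3 : (l : ℝ) ≤ c₂ * (Z * n) := by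
      refine h1.trans (le_of_eq ?_)
      rw [hZ]
      push_cast
      ring
    have h4 : (D.updateUnit l : ℝ) ≤
        (721 * c₂ + 2) * κ * (n * D.numVars * D.maxParents) * Z := by
      calc (D.updateUnit l : ℝ) ≤ (2 * (Z * n) + 721 * (c₂ * (Z * n))) *
            (κ * (D.numVars * D.maxParents)) := h2.trans (by gcongr; linarith)
        _ = _ := by ring
    exact_mod_cast h4
  have hAO1 : (1 : ℝ≥0∞) ≤ D.sizeA ^ (H - 1) * D.sizeO ^ (H - 1) := by
    exact_mod_cast Nat.mul_pos (Nat.pow_pos hA1) (Nat.pow_pos hO1)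
  have hZe : ((D.sizeR + D.sizeO) * D.sizeS ^ (H - 1) : ℝ≥0∞) ^ 2 = Z := by
    rw [hZ]; push_cast; rfl
  rw [hZe]
  set Q := D.expectedQl γ n H b
  refine (D.expectedTime_le γ n H b).trans ?_
  calc _ ≤ c₁ * κ * (n * D.numVars * D.maxParents) * D.sizeA *
          (2 * (D.sizeA * D.sizeO : ℝ≥0∞) ^ (H - 1)) +
        ((721 * c₂ + 2 : ℝ≥0) : ℝ≥0∞) * κ * (n * D.numVars * D.maxParents) * Z * Q *
          (D.sizeA ^ (H - 1) * D.sizeO ^ (H - 1)) := by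
        refine add_le_add (by gcongr) ?_
        exact (mul_le_mul_left hup Q).trans (le_mul_of_one_le_right zero_le hAO1)
    _ = (2 * c₁ : ℝ≥0) * κ * (n * D.numVars * D.maxParents * D.sizeA ^ (H - 1) *
          D.sizeO ^ (H - 1) * D.sizeA) +
        ((721 * c₂ + 2 : ℝ≥0) : ℝ≥0∞) * κ * (n * D.numVars * D.maxParents * D.sizeA ^ (H - 1) *
          D.sizeO ^ (H - 1) * (Z * Q)) := by
        push_cast
        ring
    _ ≤ (2 * c₁ + 721 * c₂ + 2 : ℝ≥0) * κ * (n * D.numVars * D.maxParents * D.sizeA ^ (H - 1) *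
          D.sizeO ^ (H - 1) * D.sizeA) +
        ((2 * c₁ + 721 * c₂ + 2 : ℝ≥0) : ℝ≥0∞) * κ * (n * D.numVars * D.maxParents *
          D.sizeA ^ (H - 1) * D.sizeO ^ (H - 1) * (Z * Q)) := by
        gcongr
        · rw [add_assoc]; exact le_self_add
        · exact le_add_self
    _ = _ := by ring

end QBRL

theorem theorem3 (γ : ℝ) (hγ0 : 0 < γ) (hγ1 : γ < 1) :
    (∃ C : ℝ≥0, ∀ (kS kA kO kR : ℕ) (D : QBRL.DDN kS kA kO kR) (b : QBRL.Belief kS)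
      (κ : ℝ≥0) (n H : ℕ),
      D.IsBelief b → 2 ≤ D.sizeS → 2 ≤ D.sizeA * D.sizeO → 1 ≤ n → 1 ≤ H →
      (2 : ℝ≥0) ^ D.maxParents ≤ κ * D.maxParents →
      D.expectedTime γ n H b ≤
        C * κ * (n * D.numVars * D.maxParents * D.sizeA ^ (H - 1) * D.sizeO ^ (H - 1) *
          (D.sizeA + ((D.sizeR + D.sizeO) * D.sizeS ^ (H - 1)) ^ 2 *
            D.expectedQl γ n H b))) ∧
    (∀ rmax : ℝ, 0 < rmax → ∀ η : ℝ, 0 < η → η < 1 →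
      ∃ C : ℝ≥0, ∀ (kS kA kO kR : ℕ) (D : QBRL.DDN kS kA kO kR) (b : QBRL.Belief kS)
      (κ : ℝ≥0) (n H T : ℕ) (ε δ : ℝ),
      D.IsBelief b → 2 ≤ D.sizeS → 2 ≤ D.sizeA * D.sizeO → 1 ≤ H → 1 ≤ T →
      IsGreatest ((fun r => |D.rewardValue r|) '' (D.rewards : Set (QBRL.Bits kR))) rmax →
      0 < δ → δ < 1 → 0 < ε → ε ≤ 2 * QBRL.effHorizon γ * rmax →
      2 * γ ^ H * QBRL.effHorizon γ * rmax ≤ η * ε →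
      n = QBRL.rewardSamples γ rmax D.sizeS D.sizeA D.sizeO ε δ T H →
      (2 : ℝ≥0) ^ D.maxParents ≤ κ * D.maxParents →
      D.expectedTime γ n H b ≤
        C * κ * (D.numVars * D.maxParents * D.sizeA ^ (H - 1) * D.sizeO ^ (H - 1) *
          (D.sizeA + ((D.sizeR + D.sizeO) * D.sizeS ^ (H - 1)) ^ 2 *
            D.expectedQl γ n H b) *
          ENNReal.ofReal (((D.sizeS : ℝ) ^ T / ε) ^ 2 *
            Real.log (((T : ℝ) + H / (D.sizeA * D.sizeO)) *
              ((D.sizeA : ℝ) ^ (H + 1) * (D.sizeO : ℝ) ^ H / δ))))) := by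
  obtain ⟨c₁, hc₁⟩ : ∃ c : ℝ≥0, (c : ℝ) = 7 + 3 * (γ * QBRL.effHorizon γ) ^ 2 :=
    ⟨⟨_, by positivity⟩, rfl⟩
  obtain ⟨c₂, hc₂⟩ : ∃ c : ℝ≥0, (c : ℝ) = 9 / 4 * (1 + γ * QBRL.effHorizon γ) ^ 2 + 1 :=
    ⟨⟨_, by positivity⟩, rfl⟩
  refine ⟨⟨2 * c₁ + 721 * c₂ + 2, fun kS kA kO kR D b κ n H _ hS hAO hn hH hκ =>
    D.expectedTime_le_of_sparse hγ0 hγ1 b hS hAO hn hH hκ hc₁ hc₂⟩,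
    fun rmax hr η _ hη => ?_⟩
  obtain ⟨c₃, hc₃⟩ : ∃ c : ℝ≥0, (c : ℝ) =
      5 / 2 * (rmax / (1 - η) * (8 * QBRL.effHorizon γ + 4)) ^ 2 +
        2 * (2 * QBRL.effHorizon γ * rmax) ^ 2 := ⟨⟨_, by positivity⟩, rfl⟩
  refine ⟨(2 * c₁ + 721 * c₂ + 2) * c₃, fun kS kA kO kR D b κ n H T ε δ _ hS hAO hH hT _ hδ0 hδ1
    hε hε2 hη2 hn hκ => ?_⟩
  have hA1 : 1 ≤ D.sizeA := Nat.pos_of_ne_zero fun h => by simp [h] at hAO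
  have hO1 : 1 ≤ D.sizeO := Nat.pos_of_ne_zero fun h => by simp [h] at hAO
  obtain ⟨hn1, hle⟩ := QBRL.rewardSamples_pos_and_le (S := D.sizeS) (A := D.sizeA) (O := D.sizeO)
    hγ0 hγ1 hr hη (by exact_mod_cast (by omega : 1 ≤ D.sizeS)) (by exact_mod_cast hA1)
    (by exact_mod_cast hAO) (by exact_mod_cast hO1) hδ0 hδ1 hε hε2 hT hH hη2
  rw [← hn] at hn1 hle
  rw [← hc₃] at hle
  refine (D.expectedTime_le_of_sparse hγ0 hγ1 b hS hAO hn1 hH hκ hc₁ hc₂).trans ?_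
  set Y := ((D.sizeS : ℝ) ^ T / ε) ^ 2 * Real.log (((T : ℝ) + H / (D.sizeA * D.sizeO)) *
    ((D.sizeA : ℝ) ^ (H + 1) * (D.sizeO : ℝ) ^ H / δ))
  have hnY : (n : ℝ≥0∞) ≤ c₃ * ENNReal.ofReal Y := by
    rw [← ENNReal.ofReal_natCast, ← ENNReal.ofReal_coe_nnreal,
      ← ENNReal.ofReal_mul (NNReal.coe_nonneg _)]
    exact ENNReal.ofReal_le_ofReal hle
  calc _ ≤ ((2 * c₁ + 721 * c₂ + 2 : ℝ≥0) : ℝ≥0∞) * κ *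
        (c₃ * ENNReal.ofReal Y * D.numVars * D.maxParents * D.sizeA ^ (H - 1) *
          D.sizeO ^ (H - 1) * (D.sizeA + ((D.sizeR + D.sizeO) * D.sizeS ^ (H - 1)) ^ 2 *
            D.expectedQl γ n H b)) := by gcongr
    _ = _ := by
        rw [ENNReal.coe_mul]
        ring
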